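/- Let $(M,g)$ be a smooth Riemannian manifold (without boundary) of dimension $n\ge 4$, and let $[g]=\{e^{2f}g : f\in C^\infty(M)\}$ be its conformal class. For a metric $h$ with $(0,4)$ curvature tensor $R$, Ricci tensor $\mathrm{Ric}$ and scalar curvature $s$, let $S=\frac1{n-2}\bigl(\mathrm{Ric}-\frac{s}{2(n-1)}h\bigr)$ be the Schouten tensor and let $W$ be the Weyl tensor, defined by $R=W+S\owedge h$, where $(\alpha\owedge\beta)_{ijkl}=\alpha_{ik}\beta_{jl}+\beta_{ik}\alpha_{jl}-\alpha_{il}\beta_{jk}-\alpha_{jk}\beta_{il}$. At a point $p$, regard $W$ as the endomorphism $W_p$ of $\Lambda^2(T_pM)$ determined by $\langle W_p(x\wedge y),z\wedge t\rangle=W(x,y,z,t)$, where $\langle x\wedge y,z\wedge t\rangle=h(x,z)h(y,t)-h(x,t)h(y,z)$. For $v\in T_pM$ put $v\wedge v^\perp=\{v\wedge w : w\in T_pM,\ h(v,w)=0\}$; a bivector is called simple if it has the form $x\wedge y$ with $x,y\in T_pM$. Assume that some metric $\tilde g\in[g]$ admits a smooth vector field $X$ that is parallel for the Levi-Civita connection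 of $\tilde g$ (that is, $\tilde\nabla X=0$) and does not vanish identically on any connected component of $M$ (for connected $M$: $X\neq 0$). Then for every $p\in M$ there is a non-zero vector $v\in T_pM$ such that, for every metric $h\in[g]$, the Weyl operator $W_p$ of $h$ satisfies $$W_p(v\wedge v^\perp)\subset v\wedge v^\perp .$$ In particular, for every $p\in M$ and every metric $h\in[g]$, the Weyl operator $W_p$ of $h$ has at least $n-1$ linearly independent eigenvectors which are simple bivectors. -/

import Mathlib

open scoped Manifold ContDiff

noncomputable section

namespace ConformalWeyl

/-! ### Curvature of a metric given by its matrix of components on a domain of `ℝⁿ`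

`G y i j = g_{ij}(y)`, and `(G y)⁻¹ i j = g^{ij}(y)`. -/

section Local

variable {n : ℕ}

/-- The partial derivative `∂_i f (y)`. -/
def partialDeriv (i : Fin n) (f : EuclideanSpace ℝ (Fin n) → ℝ)
    (y : EuclideanSpace ℝ (Fin n)) : ℝ :=
  fderiv ℝ f y (EuclideanSpace.single i 1)

variable (G : EuclideanSpace ℝ (Fin n) → Matrix (Fin n) (Fin n) ℝ)

/-- The Christoffel symbols of the Levi-Civita connection: `christoffel G k i j y = Γ^k_{ij}(y)`,
so that `∇_{∂_i} ∂_j = ∑_k Γ^k_{ij} ∂_k`. -/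
def christoffel (k i j : Fin n) (y : EuclideanSpace ℝ (Fin n)) : ℝ :=
  (1 / 2) * ∑ l, (G y)⁻¹ k l *
    (partialDeriv i (fun z => G z j l) y + partialDeriv j (fun z => G z i l) y
      - partialDeriv l (fun z => G z i j) y)

/-- The `m`-th component of
`R(∂_i, ∂_j) ∂_l = ∇_{∂_i} ∇_{∂_j} ∂_l - ∇_{∂_j} ∇_{∂_i} ∂_l`. -/
def curvatureUp (m i j l : Fin n) (y : EuclideanSpace ℝ (Fin n)) : ℝ :=
  partialDeriv i (christoffel G m j l) y - partialDeriv j (christoffel G m i l) y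
    + ∑ s, (christoffel G m i s y * christoffel G s j l y
      - christoffel G m j s y * christoffel G s i l y)

/-- The `(0,4)` curvature tensor `R_{ijkl} = g(R(∂_i, ∂_j) ∂_l, ∂_k)`; with this convention
`R_{ijij}` is positive on round spheres. -/
def riemann (i j k l : Fin n) (y : EuclideanSpace ℝ (Fin n)) : ℝ :=
  ∑ m, G y k m * curvatureUp G m i j l y

/-- The Ricci tensor `Ric_{ik} = ∑ g^{jl} R_{ijkl}`. -/
def ricci (i k : Fin n) (y : EuclideanSpace ℝ (Fin n)) : ℝ :=
  ∑ j, ∑ l, (G y)⁻¹ j l * riemann G i j k l y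

/-- The scalar curvature `s = ∑ g^{ik} Ric_{ik}`. -/
def scalarCurvature (y : EuclideanSpace ℝ (Fin n)) : ℝ :=
  ∑ i, ∑ k, (G y)⁻¹ i k * ricci G i k y

/-- The Schouten tensor `S = (Ric - s g / (2 (n - 1))) / (n - 2)`. -/
def schouten (i k : Fin n) (y : EuclideanSpace ℝ (Fin n)) : ℝ :=
  (1 / ((n : ℝ) - 2)) *
    (ricci G i k y - 1 / (2 * ((n : ℝ) - 1)) * scalarCurvature G y * G y i k)

/-- The Kulkarni-Nomizu product of two symmetric `2`-tensors. -/
def kulkarniNomizu (a b : Fin n → Fin n → ℝ) (i j k l : Fin n) : ℝ :=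
  a i k * b j l + b i k * a j l - a i l * b j k - a j k * b i l

/-- The `(0,4)` Weyl tensor, defined by the decomposition `R = W + S ∧ g` with the
Kulkarni-Nomizu product. -/
def weyl (i j k l : Fin n) (y : EuclideanSpace ℝ (Fin n)) : ℝ :=
  riemann G i j k l y
    - kulkarniNomizu (fun a b => schouten G a b y) (fun a b => G y a b) i j k l

end Local

section Global

variable {n : ℕ} {M : Type*} [TopologicalSpace M] [ChartedSpace (EuclideanSpace ℝ (Fin n)) M]

/-- Smooth vector fields on `M`. -/
def IsSmoothVectorField [IsManifold (𝓡 n) ∞ M] (X : ∀ p : M, TangentSpace (𝓡 n) p) : Prop :=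
  ContMDiff (𝓡 n) (𝓡 n).tangent ∞
    (fun p => (⟨p, X p⟩ : TangentBundle (𝓡 n) M))

variable (n M) in
/-- Smooth Riemannian metrics on the `n`-dimensional manifold `M`. -/
abbrev SmoothMetric [IsManifold (𝓡 n) ∞ M] : Type _ :=
  Bundle.ContMDiffRiemannianMetric (𝓡 n) ∞ (EuclideanSpace ℝ (Fin n))
    (TangentSpace (𝓡 n) : M → Type _)

variable [IsManifold (𝓡 n) ∞ M]

/-- `g'` belongs to the conformal class `[g]`: `g' = e^{2f} g` for a smooth function `f`. -/
def IsConformalTo (g g' : SmoothMetric n M) : Prop :=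
  ∃ f : M → ℝ, ContMDiff (𝓡 n) 𝓘(ℝ, ℝ) ∞ f ∧
    ∀ (p : M) (v w : TangentSpace (𝓡 n) p),
      g'.inner p v w = Real.exp (2 * f p) * g.inner p v w

/-- The coordinate vector field `∂_i` of the preferred chart around `p`, at the point with
coordinates `y`. -/
def coordField (p : M) (i : Fin n) (y : EuclideanSpace ℝ (Fin n)) :
    TangentSpace (𝓡 n) ((extChartAt (𝓡 n) p).symm y) :=
  mfderiv 𝓘(ℝ, EuclideanSpace ℝ (Fin n)) (𝓡 n) (extChartAt (𝓡 n) p).symm y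
    (EuclideanSpace.single i 1 : EuclideanSpace ℝ (Fin n))

/-- The components `g_{ij} = g(∂_i, ∂_j)` in the preferred chart around `p`. -/
def metricInChart (g : SmoothMetric n M) (p : M) (y : EuclideanSpace ℝ (Fin n)) :
    Matrix (Fin n) (Fin n) ℝ :=
  Matrix.of fun i j =>
    g.inner ((extChartAt (𝓡 n) p).symm y) (coordField p i y) (coordField p j y)

/-- The component `X^k` of a vector field in the preferred chart around `p`. -/
def fieldInChart (X : ∀ q : M, TangentSpace (𝓡 n) q) (p : M) (k : Fin n)
    (y : EuclideanSpace ℝ (Fin n)) : ℝ :=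
  (EuclideanSpace.proj k : EuclideanSpace ℝ (Fin n) →L[ℝ] ℝ)
    (mfderiv (𝓡 n) 𝓘(ℝ, EuclideanSpace ℝ (Fin n)) (extChartAt (𝓡 n) p)
      ((extChartAt (𝓡 n) p).symm y) (X ((extChartAt (𝓡 n) p).symm y)))

/-- `X` is parallel for the Levi-Civita connection of `g`, that is `∇ X = 0`: in the chart around
every point, `∂_i X^k + ∑_j Γ^k_{ij} X^j = 0` on the whole chart domain. -/
def IsParallel (g : SmoothMetric n M) (X : ∀ p : M, TangentSpace (𝓡 n) p) : Prop :=
  ∀ p : M, ∀ y ∈ (extChartAt (𝓡 n) p).target, ∀ i k : Fin n,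
    partialDeriv i (fieldInChart X p k) y
      + ∑ j, christoffel (metricInChart g p) k i j y * fieldInChart X p j y = 0

/-- The metric `g` admits a parallel vector field. The zero field is excluded: the field must not
vanish identically on any connected component of `M` (for connected `M` this says that it is
not the zero field). -/
def AdmitsParallelField (g : SmoothMetric n M) : Prop :=
  ∃ X : ∀ p : M, TangentSpace (𝓡 n) p, IsSmoothVectorField X ∧ IsParallel g X ∧
    ∀ p : M, ∃ q ∈ connectedComponent p, X q ≠ 0

variable (n) in
/-- The space `Λ²(T_p M)` of bivectors at `p`. -/
abbrev Bivector (p : M) : Type _ := ⋀[ℝ]^2 (TangentSpace (𝓡 n) p)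

/-- The simple bivector `x ∧ y`. -/
def wedge {p : M} (x y : TangentSpace (𝓡 n) p) : Bivector n p :=
  exteriorPower.ιMulti ℝ 2 ![x, y]

/-- A bivector is simple if it equals `x ∧ y` for some tangent vectors `x`, `y`. -/
def IsSimpleBivector {p : M} (b : Bivector n p) : Prop :=
  ∃ x y : TangentSpace (𝓡 n) p, b = wedge x y

variable (n) in
/-- The basis vector `∂_i` of `T_p M` given by the preferred chart at `p`. In Mathlib the space
`T_p M` is the model space, a vector being given by its components in the preferred chart at `p`. -/
def tangentBasis (p : M) (i : Fin n) : TangentSpace (𝓡 n) p :=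
  (EuclideanSpace.single i 1 : EuclideanSpace ℝ (Fin n))

variable (n) in
/-- The coordinate covector `dx^i` at `p`. -/
def tangentCoord (p : M) (i : Fin n) : Module.Dual ℝ (TangentSpace (𝓡 n) p) :=
  (EuclideanSpace.proj i : EuclideanSpace ℝ (Fin n) →L[ℝ] ℝ).toLinearMap

variable (n) in
/-- The component `b^{ij}` of a bivector `b = (1/2) ∑ b^{ij} ∂_i ∧ ∂_j`; for `b = x ∧ y` it is
`x^i y^j - x^j y^i`. -/
def bivectorCoord (p : M) (i j : Fin n) : Module.Dual ℝ (Bivector n p) :=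
  exteriorPower.pairingDual ℝ (TangentSpace (𝓡 n) p) 2
    (exteriorPower.ιMulti ℝ 2 ![tangentCoord n p i, tangentCoord n p j])

/-- The components at `p` of the `(0,4)` Weyl tensor of `g`. -/
def weylAt (g : SmoothMetric n M) (p : M) (i j k l : Fin n) : ℝ :=
  weyl (metricInChart g p) i j k l (extChartAt (𝓡 n) p p)

/-- The inverse matrix `g^{ij}` at `p`. -/
def inverseMetricAt (g : SmoothMetric n M) (p : M) : Matrix (Fin n) (Fin n) ℝ :=
  (metricInChart g p (extChartAt (𝓡 n) p p))⁻¹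

/-- The Weyl tensor as an endomorphism of `Λ²(T_p M)`. It is the operator with
`⟨W (x ∧ y), z ∧ t⟩ = W(x, y, z, t)` for the inner product
`⟨x ∧ y, z ∧ t⟩ = g(x, z) g(y, t) - g(x, t) g(y, z)`; in components,
`W (∂_i ∧ ∂_j) = (1/2) ∑ W_{ijab} g^{ak} g^{bl} ∂_k ∧ ∂_l`. -/
def weylOperator (g : SmoothMetric n M) (p : M) : Module.End ℝ (Bivector n p) :=
  ∑ i, ∑ j, ∑ k, ∑ l,
    ((1 / 4) * ∑ a, ∑ b,
      weylAt g p i j a b * inverseMetricAt g p a k * inverseMetricAt g p b l) •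
      (bivectorCoord n p i j).smulRight (wedge (tangentBasis n p k) (tangentBasis n p l))

/-- The set `v ∧ v^⊥ = {v ∧ w | g(v, w) = 0}` of bivectors at `p`. -/
def flag (g : SmoothMetric n M) (p : M) (v : TangentSpace (𝓡 n) p) : Set (Bivector n p) :=
  {b | ∃ w : TangentSpace (𝓡 n) p, g.inner p v w = 0 ∧ b = wedge v w}

end Global

end ConformalWeyl

end

/-!
Let `g` be the metric of the conformal class carrying the parallel field, and `v = X p`. Then
`R(v, ·, ·, ·) = 0`: this is the commutation of covariant derivatives applied to `∇X = 0`. Hence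
`W(v, ·, ·, ·)` is minus the contraction of `S ∧ g` with `v`, and `Ric(v, ·) = 0` makes `v` an
eigenvector of `S`; so `W (v ∧ w) = v ∧ E w` with a self-adjoint endomorphism `E` fixing the line
of `v`. Then `E` preserves `v^⊥`, and its `n - 1` independent eigenvectors `w_i` there give the
eigenvectors `v ∧ w_i`. Under a conformal change the curvature changes by a Kulkarni–Nomizu
product with the metric, which the Schouten tensor absorbs: the Weyl operator is only rescaled,
and `v ∧ v^⊥` does not change.
-/

noncomputable section

open scoped Matrix Matrix.Norms.Operator

namespace ConformalWeyl

section PartialDerivatives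

variable {n : ℕ} {E F H : Type*} [NormedAddCommGroup E] [NormedSpace ℝ E]
  [NormedAddCommGroup F] [NormedSpace ℝ F] [NormedAddCommGroup H] [NormedSpace ℝ H]

/-- The partial derivative `∂_i u (y)` of a function with values in a normed space; on real-valued
functions it is `partialDeriv`. -/
def pderiv (i : Fin n) (u : EuclideanSpace ℝ (Fin n) → E) (y : EuclideanSpace ℝ (Fin n)) : E :=
  fderiv ℝ u y (EuclideanSpace.single i 1)

variable {U : Set (EuclideanSpace ℝ (Fin n))} {y : EuclideanSpace ℝ (Fin n)}
  {u u₁ u₂ : EuclideanSpace ℝ (Fin n) → E} {v : EuclideanSpace ℝ (Fin n) → F}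

lemma differentiableAt_of_contDiffOn (hU : IsOpen U) (hu : ContDiffOn ℝ ∞ u U) (hy : y ∈ U) :
    DifferentiableAt ℝ u y :=
  (hu.contDiffAt (hU.mem_nhds hy)).differentiableAt (by simp)

lemma contDiffOn_pderiv (hU : IsOpen U) (hu : ContDiffOn ℝ ∞ u U) (i : Fin n) :
    ContDiffOn ℝ ∞ (pderiv i u) U :=
  (hu.fderiv_of_isOpen hU (m := ∞) le_rfl).clm_apply contDiffOn_const

lemma pderiv_comm (hU : IsOpen U) (hu : ContDiffOn ℝ ∞ u U) (hy : y ∈ U) (i j : Fin n) :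
    pderiv i (pderiv j u) y = pderiv j (pderiv i u) y := by
  have hd : DifferentiableAt ℝ (fderiv ℝ u) y :=
    differentiableAt_of_contDiffOn hU (hu.fderiv_of_isOpen hU (m := ∞) le_rfl) hy
  have hsecond (i j : Fin n) : pderiv i (pderiv j u) y
      = fderiv ℝ (fderiv ℝ u) y (EuclideanSpace.single i 1) (EuclideanSpace.single j 1) := by
    unfold pderiv
    simp [fderiv_clm_apply hd (differentiableAt_const _)]
  have hsymm : IsSymmSndFDerivAt ℝ u y :=
    (hu.contDiffAt (hU.mem_nhds hy)).isSymmSndFDerivAt (by simpa using ENat.LEInfty.out)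
  rw [hsecond, hsecond, hsymm]

lemma pderiv_congr (hU : IsOpen U) (h : Set.EqOn u₁ u₂ U) (hy : y ∈ U) (i : Fin n) :
    pderiv i u₁ y = pderiv i u₂ y := by
  rw [pderiv, pderiv, (h.eventuallyEq_of_mem (hU.mem_nhds hy)).fderiv_eq]

lemma pderiv_const (i : Fin n) (e : E) : pderiv i (fun _ => e) y = 0 := by
  simp [pderiv]

lemma pderiv_add (h₁ : DifferentiableAt ℝ u₁ y) (h₂ : DifferentiableAt ℝ u₂ y) (i : Fin n) :
    pderiv i (fun z => u₁ z + u₂ z) y = pderiv i u₁ y + pderiv i u₂ y := by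
  simp [pderiv, fderiv_fun_add h₁ h₂]

lemma pderiv_neg (i : Fin n) : pderiv i (fun z => -u z) y = -pderiv i u y := by
  simp [pderiv, fderiv_fun_neg]

lemma pderiv_sub (h₁ : DifferentiableAt ℝ u₁ y) (h₂ : DifferentiableAt ℝ u₂ y) (i : Fin n) :
    pderiv i (fun z => u₁ z - u₂ z) y = pderiv i u₁ y - pderiv i u₂ y := by
  simp [pderiv, fderiv_fun_sub h₁ h₂]

lemma pderiv_linearMap [FiniteDimensional ℝ E] (L : E →ₗ[ℝ] F) (hu : DifferentiableAt ℝ u y)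
    (i : Fin n) : pderiv i (fun z => L (u z)) y = L (pderiv i u y) := by
  have h := (L.toContinuousLinearMap.hasFDerivAt (x := u y)).comp y hu.hasFDerivAt
  exact congrArg (fun D => D (EuclideanSpace.single i 1)) h.fderiv

lemma pderiv_bilinear [FiniteDimensional ℝ E] [FiniteDimensional ℝ F] (B : E →ₗ[ℝ] F →ₗ[ℝ] H)
    (hu : DifferentiableAt ℝ u y) (hv : DifferentiableAt ℝ v y) (i : Fin n) :
    pderiv i (fun z => B (u z) (v z)) y = B (pderiv i u y) (v y) + B (u y) (pderiv i v y) := by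
  have h := B.toContinuousBilinearMap.fderiv_of_bilinear hu hv
  exact (congrArg (fun D => D (EuclideanSpace.single i 1)) h).trans (add_comm _ _)

lemma differentiableAt_bilinear [FiniteDimensional ℝ E] [FiniteDimensional ℝ F]
    (B : E →ₗ[ℝ] F →ₗ[ℝ] H) (hu : DifferentiableAt ℝ u y) (hv : DifferentiableAt ℝ v y) :
    DifferentiableAt ℝ (fun z => B (u z) (v z)) y :=
  (B.toContinuousBilinearMap.hasFDerivAt_of_bilinear hu.hasFDerivAt hv.hasFDerivAt).differentiableAt

lemma pderiv_smul {c : EuclideanSpace ℝ (Fin n) → ℝ} (hc : DifferentiableAt ℝ c y)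
    (hu : DifferentiableAt ℝ u y) (i : Fin n) :
    pderiv i (fun z => c z • u z) y = pderiv i c y • u y + c y • pderiv i u y := by
  simp [pderiv, fderiv_fun_smul hc hu, add_comm]

lemma pderiv_exp_two_mul {f : EuclideanSpace ℝ (Fin n) → ℝ} (hf : DifferentiableAt ℝ f y)
    (i : Fin n) :
    pderiv i (fun z => Real.exp (2 * f z)) y = Real.exp (2 * f y) * (2 * pderiv i f y) := by
  simp [pderiv, fderiv_exp (hf.const_mul 2), fderiv_const_mul hf]

lemma euclideanSpace_eq_sum (u : EuclideanSpace ℝ (Fin n)) :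
    u = ∑ k, u k • EuclideanSpace.single k (1 : ℝ) := by
  simpa using ((EuclideanSpace.basisFun (Fin n) ℝ).sum_repr u).symm

lemma fderiv_eq_zero_of_pderiv_eq_zero (h : ∀ i, pderiv i u y = 0) :
    fderiv ℝ u y = 0 := by
  ext w
  rw [euclideanSpace_eq_sum w, map_sum]
  exact Finset.sum_eq_zero fun i _ => by rw [map_smul, ← pderiv, h i, smul_zero]

end PartialDerivatives

section MatrixCalculus

variable {n : ℕ} {U : Set (EuclideanSpace ℝ (Fin n))} {y : EuclideanSpace ℝ (Fin n)}
  {A B : EuclideanSpace ℝ (Fin n) → Matrix (Fin n) (Fin n) ℝ}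
  {a b : EuclideanSpace ℝ (Fin n) → Fin n → ℝ}

lemma contDiffOn_matrix :
    ContDiffOn ℝ ∞ A U ↔ ∀ i j, ContDiffOn ℝ ∞ (fun z => A z i j) U := by
  refine ⟨fun h i j =>
    (Matrix.entryLinearMap ℝ ℝ i j).toContinuousLinearMap.contDiff.comp_contDiffOn h, fun h => ?_⟩
  rw [show A = fun z => ∑ i, ∑ j, A z i j • Matrix.single i j (1 : ℝ) from
    funext fun z => by simpa using Matrix.matrix_eq_sum_single (A z)]
  exact ContDiffOn.sum fun i _ => ContDiffOn.sum fun j _ => (h i j).smul contDiffOn_const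

lemma contDiffOn_inv_matrix (hA : ContDiffOn ℝ ∞ A U) (hdet : ∀ z ∈ U, IsUnit (A z).det) :
    ContDiffOn ℝ ∞ (fun z => (A z)⁻¹) U := by
  intro z hz
  obtain ⟨w, hw⟩ := (Matrix.isUnit_iff_isUnit_det _).2 (hdet z hz)
  simp only [Matrix.nonsing_inv_eq_ringInverse]
  exact (hw ▸ contDiffAt_ringInverse ℝ w).comp_contDiffWithinAt z (hA z hz)

lemma pderiv_apply_apply (hA : DifferentiableAt ℝ A y) (i j k : Fin n) :
    pderiv i (fun z => A z j k) y = pderiv i A y j k :=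
  pderiv_linearMap (Matrix.entryLinearMap ℝ ℝ j k) hA i

lemma differentiableAt_transpose (hA : DifferentiableAt ℝ A y) :
    DifferentiableAt ℝ (fun z => (A z)ᵀ) y :=
  (Matrix.transposeLinearEquiv (Fin n) (Fin n) ℝ ℝ).toLinearMap.toContinuousLinearMap
    |>.differentiableAt.comp y hA

lemma pderiv_matrix_transpose (hA : DifferentiableAt ℝ A y) (i : Fin n) :
    pderiv i (fun z => (A z)ᵀ) y = (pderiv i A y)ᵀ :=
  pderiv_linearMap (Matrix.transposeLinearEquiv (Fin n) (Fin n) ℝ ℝ).toLinearMap hA i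

lemma pderiv_matrix_mul (hA : DifferentiableAt ℝ A y) (hB : DifferentiableAt ℝ B y) (i : Fin n) :
    pderiv i (fun z => A z * B z) y = pderiv i A y * B y + A y * pderiv i B y :=
  pderiv_bilinear (mulLinearMap ℝ) hA hB i

lemma differentiableAt_mulVec (hA : DifferentiableAt ℝ A y) (ha : DifferentiableAt ℝ a y) :
    DifferentiableAt ℝ (fun z => A z *ᵥ a z) y :=
  differentiableAt_bilinear (Matrix.mulVecBilin ℝ ℝ) hA ha

lemma pderiv_mulVec (hA : DifferentiableAt ℝ A y) (ha : DifferentiableAt ℝ a y) (i : Fin n) :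
    pderiv i (fun z => A z *ᵥ a z) y = pderiv i A y *ᵥ a y + A y *ᵥ pderiv i a y :=
  pderiv_bilinear (Matrix.mulVecBilin ℝ ℝ) hA ha i

lemma differentiableAt_vecMulVec (ha : DifferentiableAt ℝ a y) (hb : DifferentiableAt ℝ b y) :
    DifferentiableAt ℝ (fun z => Matrix.vecMulVec (a z) (b z)) y :=
  differentiableAt_bilinear (vecMulVecBilin ℝ ℝ) ha hb

lemma pderiv_vecMulVec (ha : DifferentiableAt ℝ a y) (hb : DifferentiableAt ℝ b y) (i : Fin n) :
    pderiv i (fun z => Matrix.vecMulVec (a z) (b z)) y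
      = Matrix.vecMulVec (pderiv i a y) (b y) + Matrix.vecMulVec (a y) (pderiv i b y) :=
  pderiv_bilinear (vecMulVecBilin ℝ ℝ) ha hb i

lemma differentiableAt_dotProduct (ha : DifferentiableAt ℝ a y) (hb : DifferentiableAt ℝ b y) :
    DifferentiableAt ℝ (fun z => a z ⬝ᵥ b z) y :=
  differentiableAt_bilinear (dotProductBilin ℝ ℝ) ha hb

lemma pderiv_dotProduct (ha : DifferentiableAt ℝ a y) (hb : DifferentiableAt ℝ b y) (i : Fin n) :
    pderiv i (fun z => a z ⬝ᵥ b z) y = pderiv i a y ⬝ᵥ b y + a y ⬝ᵥ pderiv i b y :=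
  pderiv_bilinear (dotProductBilin ℝ ℝ) ha hb i

end MatrixCalculus

section LeviCivita

variable {n : ℕ}

/-- `G` is the component matrix of a smooth pseudo-Riemannian metric on the open set `U`. -/
structure IsMetricOn (G : EuclideanSpace ℝ (Fin n) → Matrix (Fin n) (Fin n) ℝ)
    (U : Set (EuclideanSpace ℝ (Fin n))) : Prop where
  isOpen : IsOpen U
  contDiffOn : ContDiffOn ℝ ∞ G U
  isSymm : ∀ y ∈ U, (G y).IsSymm
  isUnit_det : ∀ y ∈ U, IsUnit (G y).det

/-- The Christoffel symbols of the first kind: the entry `(k, j)` is `∑ g_{km} Γ^m_{ij}`. -/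
def lowerConnectionMatrix (G : EuclideanSpace ℝ (Fin n) → Matrix (Fin n) (Fin n) ℝ) (i : Fin n)
    (y : EuclideanSpace ℝ (Fin n)) : Matrix (Fin n) (Fin n) ℝ :=
  Matrix.of fun k j => (1 / 2) * (partialDeriv i (fun z => G z j k) y
    + partialDeriv j (fun z => G z i k) y - partialDeriv k (fun z => G z i j) y)

/-- The `∂_i`-component of the matrix of connection `1`-forms: `∇_{∂_i} X = ∂_i X + Γ_i X` on
columns of components, the entry `(k, j)` of `Γ_i` being `Γ^k_{ij}`. -/
def connectionMatrix (G : EuclideanSpace ℝ (Fin n) → Matrix (Fin n) (Fin n) ℝ) (i : Fin n)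
    (y : EuclideanSpace ℝ (Fin n)) : Matrix (Fin n) (Fin n) ℝ :=
  Matrix.of fun k j => christoffel G k i j y

/-- The curvature `2`-form `dθ + θ ∧ θ` of the connection `d + θ`, evaluated on `∂_i, ∂_j`. -/
def curvatureForm (θ : Fin n → EuclideanSpace ℝ (Fin n) → Matrix (Fin n) (Fin n) ℝ) (i j : Fin n)
    (y : EuclideanSpace ℝ (Fin n)) : Matrix (Fin n) (Fin n) ℝ :=
  pderiv i (θ j) y - pderiv j (θ i) y + (θ i y * θ j y - θ j y * θ i y)

variable {G : EuclideanSpace ℝ (Fin n) → Matrix (Fin n) (Fin n) ℝ}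
  {U : Set (EuclideanSpace ℝ (Fin n))} {y : EuclideanSpace ℝ (Fin n)}

lemma connectionMatrix_eq_inv_mul (i : Fin n) (y : EuclideanSpace ℝ (Fin n)) :
    connectionMatrix G i y = (G y)⁻¹ * lowerConnectionMatrix G i y := by
  ext k j
  simp only [connectionMatrix, christoffel, lowerConnectionMatrix, Matrix.of_apply,
    Matrix.mul_apply, Finset.mul_sum]
  exact Finset.sum_congr rfl fun l _ => by ring

lemma riemann_swap (i j k l : Fin n) (y : EuclideanSpace ℝ (Fin n)) :
    riemann G j i k l y = -riemann G i j k l y := by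
  simp only [riemann, curvatureUp, ← Finset.sum_neg_distrib, Finset.sum_sub_distrib]
  exact Finset.sum_congr rfl fun m _ => by ring

namespace IsMetricOn

lemma differentiableAt (hG : IsMetricOn G U) (hy : y ∈ U) : DifferentiableAt ℝ G y :=
  differentiableAt_of_contDiffOn hG.isOpen hG.contDiffOn hy

lemma inv_isSymm (hG : IsMetricOn G U) (hy : y ∈ U) : ((G y)⁻¹).IsSymm := by
  rw [Matrix.IsSymm, Matrix.transpose_nonsing_inv, hG.isSymm y hy]

lemma mul_connectionMatrix (hG : IsMetricOn G U) (hy : y ∈ U) (i : Fin n) :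
    G y * connectionMatrix G i y = lowerConnectionMatrix G i y := by
  rw [connectionMatrix_eq_inv_mul, Matrix.mul_nonsing_inv_cancel_left _ _ (hG.isUnit_det y hy)]

lemma contDiffOn_connectionMatrix (hG : IsMetricOn G U) (i : Fin n) :
    ContDiffOn ℝ ∞ (connectionMatrix G i) U := by
  have hpartial (a b c : Fin n) : ContDiffOn ℝ ∞ (partialDeriv a (fun z => G z b c)) U :=
    contDiffOn_pderiv hG.isOpen (contDiffOn_matrix.1 hG.contDiffOn b c) a
  simp only [funext (connectionMatrix_eq_inv_mul (G := G) i)]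
  exact (contDiffOn_inv_matrix hG.contDiffOn hG.isUnit_det).mul <| contDiffOn_matrix.2 fun k j =>
    contDiffOn_const.mul (((hpartial i j k).add (hpartial j i k)).sub (hpartial k i j))

lemma differentiableAt_connectionMatrix (hG : IsMetricOn G U) (hy : y ∈ U) (i : Fin n) :
    DifferentiableAt ℝ (connectionMatrix G i) y :=
  differentiableAt_of_contDiffOn hG.isOpen (hG.contDiffOn_connectionMatrix i) hy

lemma lowerConnectionMatrix_apply (hG : IsMetricOn G U) (hy : y ∈ U) (i j k : Fin n) :
    lowerConnectionMatrix G i y k j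
      = (1 / 2) * (pderiv i G y j k + pderiv j G y i k - pderiv k G y i j) := by
  simp only [← pderiv_apply_apply (hG.differentiableAt hy)]
  rfl

lemma pderiv_isSymm (hG : IsMetricOn G U) (hy : y ∈ U) (i : Fin n) : (pderiv i G y).IsSymm := by
  rw [Matrix.IsSymm, ← pderiv_matrix_transpose (hG.differentiableAt hy)]
  exact pderiv_congr hG.isOpen (fun z hz => hG.isSymm z hz) hy i

lemma connectionMatrix_comm (hG : IsMetricOn G U) (hy : y ∈ U) (i j k : Fin n) :
    connectionMatrix G i y k j = connectionMatrix G j y k i := by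
  simp only [connectionMatrix_eq_inv_mul, Matrix.mul_apply, hG.lowerConnectionMatrix_apply hy]
  refine Finset.sum_congr rfl fun l _ => ?_
  rw [(hG.pderiv_isSymm hy l).apply i j]
  ring

lemma pderiv_metric (hG : IsMetricOn G U) (hy : y ∈ U) (i : Fin n) :
    pderiv i G y = G y * connectionMatrix G i y + (G y * connectionMatrix G i y)ᵀ := by
  ext j k
  simp only [hG.mul_connectionMatrix hy, Matrix.add_apply, Matrix.transpose_apply,
    hG.lowerConnectionMatrix_apply hy]
  linear_combination (1 / 2) * (hG.pderiv_isSymm hy i).apply k j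

lemma connectionMatrix_unique (hG : IsMetricOn G U) (hy : y ∈ U)
    {C : Fin n → Matrix (Fin n) (Fin n) ℝ} (htorsion : ∀ i j k, C i k j = C j k i)
    (hmetric : ∀ i, pderiv i G y = G y * C i + (G y * C i)ᵀ) (i : Fin n) :
    connectionMatrix G i y = C i := by
  have hsymm (i j k : Fin n) : (G y * C i) k j = (G y * C j) k i := by
    simp only [Matrix.mul_apply, htorsion i]
  have hlower : lowerConnectionMatrix G i y = G y * C i := by
    ext k j
    simp only [hG.lowerConnectionMatrix_apply hy, hmetric, Matrix.add_apply, Matrix.transpose_apply]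
    linear_combination (1 / 2) * (hsymm i k j + hsymm j k i + hsymm j i k)
  rw [connectionMatrix_eq_inv_mul, hlower,
    Matrix.nonsing_inv_mul_cancel_left _ _ (hG.isUnit_det y hy)]

lemma riemann_eq (hG : IsMetricOn G U) (hy : y ∈ U) (i j k l : Fin n) :
    riemann G i j k l y = (G y * curvatureForm (connectionMatrix G) i j y) k l := by
  simp only [riemann, curvatureUp, curvatureForm, Matrix.mul_apply, Matrix.add_apply,
    Matrix.sub_apply, ← pderiv_apply_apply (hG.differentiableAt_connectionMatrix hy _),
    Finset.sum_sub_distrib]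
  rfl

lemma curvatureForm_skew (hG : IsMetricOn G U) (hy : y ∈ U) (i j : Fin n) :
    (G y * curvatureForm (connectionMatrix G) i j y)ᵀ
      = -(G y * curvatureForm (connectionMatrix G) i j y) := by
  have hdθ := hG.differentiableAt_connectionMatrix hy
  have hsecond (i j : Fin n) : pderiv i (pderiv j G) y
      = pderiv i (fun z => G z * connectionMatrix G j z) y
        + (pderiv i (fun z => G z * connectionMatrix G j z) y)ᵀ := by
    have hd : DifferentiableAt ℝ (fun z => G z * connectionMatrix G j z) y :=
      (hG.differentiableAt hy).mul (hdθ j)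
    rw [pderiv_congr hG.isOpen (fun z hz => hG.pderiv_metric hz j) hy,
      pderiv_add hd (differentiableAt_transpose hd), pderiv_matrix_transpose hd]
  have hcomm := pderiv_comm hG.isOpen hG.contDiffOn hy i j
  simp only [hsecond, pderiv_matrix_mul (hG.differentiableAt hy) (hdθ _), hG.pderiv_metric hy,
    Matrix.transpose_add, Matrix.transpose_mul, (hG.isSymm y hy).eq, Matrix.transpose_transpose]
    at hcomm
  simp only [curvatureForm, Matrix.transpose_mul, Matrix.transpose_add, Matrix.transpose_sub,
    (hG.isSymm y hy).eq]
  linear_combination (norm := noncomm_ring) hcomm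

lemma first_bianchi (hG : IsMetricOn G U) (hy : y ∈ U) (i j k l : Fin n) :
    riemann G i j k l y + riemann G j l k i y + riemann G l i k j y = 0 := by
  have hderiv (i j l m : Fin n) : pderiv i (connectionMatrix G j) y m l
      = pderiv i (connectionMatrix G l) y m j := by
    simp only [← pderiv_apply_apply (hG.differentiableAt_connectionMatrix hy _)]
    exact pderiv_congr hG.isOpen (fun z hz => hG.connectionMatrix_comm hz j l m) hy i
  have hprod (i j l m : Fin n) : (connectionMatrix G i y * connectionMatrix G j y) m l
      = (connectionMatrix G i y * connectionMatrix G l y) m j := by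
    simp only [Matrix.mul_apply, hG.connectionMatrix_comm hy j l]
  simp only [hG.riemann_eq hy, Matrix.mul_apply (M := G y), ← Finset.sum_add_distrib, ← mul_add]
  refine Finset.sum_eq_zero fun m _ => mul_eq_zero_of_right _ ?_
  simp only [curvatureForm, Matrix.add_apply, Matrix.sub_apply]
  linear_combination hderiv i j l m + hderiv j l i m + hderiv l i j m
    + hprod i j l m + hprod j l i m + hprod l i j m

lemma riemann_pair_symm (hG : IsMetricOn G U) (hy : y ∈ U) (i j k l : Fin n) :
    riemann G i j k l y = riemann G k l i j y := by
  have hskew (i j k l : Fin n) : riemann G i j l k y = -riemann G i j k l y := by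
    simp only [hG.riemann_eq hy]
    exact congrFun (congrFun (hG.curvatureForm_skew hy i j) k) l
  linear_combination (1 / 2) * (hG.first_bianchi hy i j k l - hG.first_bianchi hy i j l k
    - hG.first_bianchi hy k l i j + hG.first_bianchi hy k l j i + hskew i j k l - hskew k l i j
    - hskew l i k j + hskew j k l i + riemann_swap j l i k y - hskew j l k i
    + riemann_swap i k l j y - hskew i k j l)

lemma ricci_symm (hG : IsMetricOn G U) (hy : y ∈ U) (i k : Fin n) :
    ricci G i k y = ricci G k i y := by
  rw [ricci, ricci, Finset.sum_comm]
  refine Finset.sum_congr rfl fun a _ => Finset.sum_congr rfl fun b _ => ?_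
  rw [hG.riemann_pair_symm hy, (hG.inv_isSymm hy).apply]

lemma schouten_symm (hG : IsMetricOn G U) (hy : y ∈ U) (i k : Fin n) :
    schouten G i k y = schouten G k i y := by
  rw [schouten, schouten, hG.ricci_symm hy, (hG.isSymm y hy).apply]

end IsMetricOn

end LeviCivita

section ParallelFields

variable {n : ℕ} {U : Set (EuclideanSpace ℝ (Fin n))} {y : EuclideanSpace ℝ (Fin n)}
  {X : EuclideanSpace ℝ (Fin n) → Fin n → ℝ}

lemma curvatureForm_mulVec_eq_zero
    {θ : Fin n → EuclideanSpace ℝ (Fin n) → Matrix (Fin n) (Fin n) ℝ} (hU : IsOpen U)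
    (hθ : ∀ i, DifferentiableAt ℝ (θ i) y) (hX : ContDiffOn ℝ ∞ X U)
    (hpar : ∀ z ∈ U, ∀ i, pderiv i X z = -(θ i z *ᵥ X z)) (hy : y ∈ U) (i j : Fin n) :
    curvatureForm θ i j y *ᵥ X y = 0 := by
  have hsecond (i j : Fin n) : pderiv i (pderiv j X) y
      = -(pderiv i (θ j) y *ᵥ X y) + (θ j y * θ i y) *ᵥ X y := by
    rw [pderiv_congr hU (fun z hz => hpar z hz j) hy, pderiv_neg,
      pderiv_mulVec (hθ j) (differentiableAt_of_contDiffOn hU hX hy), hpar y hy, Matrix.mulVec_neg,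
      Matrix.mulVec_mulVec, neg_add, neg_neg]
  have hcomm := pderiv_comm hU hX hy i j
  rw [hsecond, hsecond] at hcomm
  simp only [curvatureForm, Matrix.add_mulVec, Matrix.sub_mulVec]
  linear_combination -hcomm

variable {G : EuclideanSpace ℝ (Fin n) → Matrix (Fin n) (Fin n) ℝ}

namespace IsMetricOn

lemma sum_riemann_mul_eq_zero (hG : IsMetricOn G U) (hX : ContDiffOn ℝ ∞ X U)
    (hpar : ∀ z ∈ U, ∀ i, pderiv i X z = -(connectionMatrix G i z *ᵥ X z)) (hy : y ∈ U)
    (i j k : Fin n) : ∑ l, riemann G i j k l y * X y l = 0 := by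
  have h := curvatureForm_mulVec_eq_zero hG.isOpen (hG.differentiableAt_connectionMatrix hy) hX
    hpar hy i j
  simp only [hG.riemann_eq hy]
  change ((G y * curvatureForm (connectionMatrix G) i j y) *ᵥ X y) k = 0
  rw [← Matrix.mulVec_mulVec, h, Matrix.mulVec_zero, Pi.zero_apply]

lemma pderiv_normSq_eq_zero (hG : IsMetricOn G U) (hX : DifferentiableAt ℝ X y)
    (hy : y ∈ U) (i : Fin n) (hpar : pderiv i X y = -(connectionMatrix G i y *ᵥ X y)) :
    pderiv i (fun z => X z ⬝ᵥ G z *ᵥ X z) y = 0 := by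
  rw [pderiv_dotProduct hX (differentiableAt_mulVec (hG.differentiableAt hy) hX),
    pderiv_mulVec (hG.differentiableAt hy) hX, hpar, hG.pderiv_metric hy, Matrix.transpose_mul,
    hG.isSymm y hy, Matrix.add_mulVec, Matrix.mulVec_neg, ← Matrix.mulVec_mulVec,
    ← Matrix.mulVec_mulVec, neg_dotProduct, dotProduct_add, dotProduct_add, dotProduct_neg,
    Matrix.dotProduct_mulVec (X y) (_ᵀ), Matrix.vecMul_transpose]
  ring

end IsMetricOn

end ParallelFields

section CovariantDerivative

variable {n : ℕ}

/-- The covariant derivative `∇_{∂_i} a` of a covector field for the connection `d + θ`. -/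
def covDeriv (θ : Fin n → EuclideanSpace ℝ (Fin n) → Matrix (Fin n) (Fin n) ℝ) (i : Fin n)
    (a : EuclideanSpace ℝ (Fin n) → Fin n → ℝ) (y : EuclideanSpace ℝ (Fin n)) : Fin n → ℝ :=
  pderiv i a y - (θ i y)ᵀ *ᵥ a y

variable {θ C : Fin n → EuclideanSpace ℝ (Fin n) → Matrix (Fin n) (Fin n) ℝ}
  {y : EuclideanSpace ℝ (Fin n)}

lemma curvatureForm_congr {U : Set (EuclideanSpace ℝ (Fin n))} (hU : IsOpen U)
    (h : ∀ i, Set.EqOn (θ i) (C i) U) (hy : y ∈ U) (i j : Fin n) :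
    curvatureForm θ i j y = curvatureForm C i j y := by
  simp only [curvatureForm, pderiv_congr hU (h _) hy, h _ hy]

lemma curvatureForm_add (hθ : ∀ i, DifferentiableAt ℝ (θ i) y)
    (hC : ∀ i, DifferentiableAt ℝ (C i) y) (i j : Fin n) :
    curvatureForm (fun i z => θ i z + C i z) i j y = curvatureForm θ i j y + curvatureForm C i j y
      + (θ i y * C j y - C j y * θ i y) - (θ j y * C i y - C i y * θ j y) := by
  simp only [curvatureForm, pderiv_add (hθ _) (hC _)]
  noncomm_ring

lemma curvatureForm_add_smul_one {c : Fin n → EuclideanSpace ℝ (Fin n) → ℝ}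
    (hθ : ∀ i, DifferentiableAt ℝ (θ i) y) (hc : ∀ i, DifferentiableAt ℝ (c i) y) {i j : Fin n}
    (hclosed : pderiv i (c j) y = pderiv j (c i) y) :
    curvatureForm (fun i z => θ i z + c i z • 1) i j y = curvatureForm θ i j y := by
  rw [curvatureForm_add hθ fun i => (hc i).smul_const 1]
  simp only [curvatureForm, pderiv_smul (hc _) (differentiableAt_const _), hclosed, pderiv_const]
  simp [smul_comm (c i y)]

variable {a b : EuclideanSpace ℝ (Fin n) → Fin n → ℝ}

lemma covDeriv_vecMulVec (ha : DifferentiableAt ℝ a y) (hb : DifferentiableAt ℝ b y) (i : Fin n) :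
    pderiv i (fun z => Matrix.vecMulVec (a z) (b z)) y
        - (θ i y)ᵀ * Matrix.vecMulVec (a y) (b y) - Matrix.vecMulVec (a y) (b y) * θ i y
      = Matrix.vecMulVec (covDeriv θ i a y) (b y)
        + Matrix.vecMulVec (a y) (covDeriv θ i b y) := by
  rw [pderiv_vecMulVec ha hb, Matrix.mul_vecMulVec, Matrix.vecMulVec_mul, covDeriv, covDeriv,
    Matrix.sub_vecMulVec, Matrix.vecMulVec_sub, Matrix.mulVec_transpose, Matrix.mulVec_transpose]
  abel

end CovariantDerivative

section ConformalChange

variable {n : ℕ}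

/-- The components of the differential of `f`. -/
def differential (f : EuclideanSpace ℝ (Fin n) → ℝ) (y : EuclideanSpace ℝ (Fin n)) : Fin n → ℝ :=
  fun i => pderiv i f y

/-- The components of the covector field `g(∂_j, ·)`. -/
def coordCovector (G : EuclideanSpace ℝ (Fin n) → Matrix (Fin n) (Fin n) ℝ) (j : Fin n)
    (y : EuclideanSpace ℝ (Fin n)) : Fin n → ℝ :=
  G y *ᵥ Pi.single j 1

/-- The `2`-form `g(∂_i, ·) ∧ df`. -/
def coordWedgeDifferential (G : EuclideanSpace ℝ (Fin n) → Matrix (Fin n) (Fin n) ℝ)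
    (f : EuclideanSpace ℝ (Fin n) → ℝ) (i : Fin n) (y : EuclideanSpace ℝ (Fin n)) :
    Matrix (Fin n) (Fin n) ℝ :=
  Matrix.vecMulVec (coordCovector G i y) (differential f y)
    - Matrix.vecMulVec (differential f y) (coordCovector G i y)

/-- The trace-free part `Z ↦ df(Z) ∂_i - g(∂_i, Z) grad f` of the difference between the
Levi-Civita connections of `e^{2f} g` and of `g` in the direction `∂_i`; the other part is the
scalar `∂_i f`. -/
def conformalShift (G : EuclideanSpace ℝ (Fin n) → Matrix (Fin n) (Fin n) ℝ)
    (f : EuclideanSpace ℝ (Fin n) → ℝ) (i : Fin n) (y : EuclideanSpace ℝ (Fin n)) :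
    Matrix (Fin n) (Fin n) ℝ :=
  (G y)⁻¹ * coordWedgeDifferential G f i y

/-- The Hessian `∇ df` of `f` for the Levi-Civita connection, row `i` being `∇_{∂_i} df`. -/
def hessian (G : EuclideanSpace ℝ (Fin n) → Matrix (Fin n) (Fin n) ℝ)
    (f : EuclideanSpace ℝ (Fin n) → ℝ) (y : EuclideanSpace ℝ (Fin n)) : Matrix (Fin n) (Fin n) ℝ :=
  Matrix.of fun i => covDeriv (connectionMatrix G) i (differential f) y

/-- The tensor `∇ df - df ⊗ df + ½ |df|² g` by which the Schouten tensor decreases when `g` is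
replaced by `e^{2f} g`. -/
def schoutenShift (G : EuclideanSpace ℝ (Fin n) → Matrix (Fin n) (Fin n) ℝ)
    (f : EuclideanSpace ℝ (Fin n) → ℝ) (y : EuclideanSpace ℝ (Fin n)) : Matrix (Fin n) (Fin n) ℝ :=
  hessian G f y - Matrix.vecMulVec (differential f y) (differential f y)
    + ((1 / 2) * (differential f y ⬝ᵥ (G y)⁻¹ *ᵥ differential f y)) • G y

variable {G G' : EuclideanSpace ℝ (Fin n) → Matrix (Fin n) (Fin n) ℝ}
  {f : EuclideanSpace ℝ (Fin n) → ℝ} {U : Set (EuclideanSpace ℝ (Fin n))}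
  {y : EuclideanSpace ℝ (Fin n)}

lemma coordWedgeDifferential_transpose (i : Fin n) :
    (coordWedgeDifferential G f i y)ᵀ = -coordWedgeDifferential G f i y := by
  simp [coordWedgeDifferential, Matrix.transpose_vecMulVec]

lemma coordCovector_apply (i j : Fin n) : coordCovector G j y i = G y i j := by
  simp [coordCovector]

lemma contDiffOn_differential (hU : IsOpen U) (hf : ContDiffOn ℝ ∞ f U) :
    ContDiffOn ℝ ∞ (differential f) U :=
  contDiffOn_pi.2 fun i => contDiffOn_pderiv hU hf i

namespace IsMetricOn

lemma mul_conformalShift (hG : IsMetricOn G U) (hy : y ∈ U) (i : Fin n) :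
    G y * conformalShift G f i y = coordWedgeDifferential G f i y := by
  rw [conformalShift, Matrix.mul_nonsing_inv_cancel_left _ _ (hG.isUnit_det y hy)]

lemma inv_mulVec_coordCovector (hG : IsMetricOn G U) (hy : y ∈ U) (j : Fin n) :
    (G y)⁻¹ *ᵥ coordCovector G j y = Pi.single j 1 := by
  rw [coordCovector, Matrix.mulVec_mulVec, Matrix.nonsing_inv_mul _ (hG.isUnit_det y hy),
    Matrix.one_mulVec]

lemma conformalShift_eq (hG : IsMetricOn G U) (hy : y ∈ U) (i : Fin n) :
    conformalShift G f i y = Matrix.vecMulVec (Pi.single i 1) (differential f y)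
      - Matrix.vecMulVec ((G y)⁻¹ *ᵥ differential f y) (coordCovector G i y) := by
  rw [conformalShift, coordWedgeDifferential, Matrix.mul_sub, Matrix.mul_vecMulVec,
    Matrix.mul_vecMulVec, hG.inv_mulVec_coordCovector hy]

lemma contDiffOn_coordCovector (hG : IsMetricOn G U) (j : Fin n) :
    ContDiffOn ℝ ∞ (coordCovector G j) U := by
  refine contDiffOn_pi.2 fun i => ?_
  simpa only [coordCovector_apply] using contDiffOn_matrix.1 hG.contDiffOn i j

lemma differentiableAt_coordWedgeDifferential (hG : IsMetricOn G U) (hf : ContDiffOn ℝ ∞ f U)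
    (hy : y ∈ U) (i : Fin n) : DifferentiableAt ℝ (coordWedgeDifferential G f i) y := by
  have hγ := differentiableAt_of_contDiffOn hG.isOpen (hG.contDiffOn_coordCovector i) hy
  have hφ := differentiableAt_of_contDiffOn hG.isOpen (contDiffOn_differential hG.isOpen hf) hy
  exact (differentiableAt_vecMulVec hγ hφ).sub (differentiableAt_vecMulVec hφ hγ)

lemma differentiableAt_conformalShift (hG : IsMetricOn G U) (hf : ContDiffOn ℝ ∞ f U)
    (hy : y ∈ U) (i : Fin n) : DifferentiableAt ℝ (conformalShift G f i) y :=
  (differentiableAt_of_contDiffOn hG.isOpen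
    (contDiffOn_inv_matrix hG.contDiffOn hG.isUnit_det) hy).mul
    (hG.differentiableAt_coordWedgeDifferential hf hy i)

lemma connectionMatrix_conformal (hG : IsMetricOn G U) (hG' : IsMetricOn G' U)
    (hf : ContDiffOn ℝ ∞ f U) (hGG' : ∀ z ∈ U, G' z = Real.exp (2 * f z) • G z) (hy : y ∈ U)
    (i : Fin n) :
    connectionMatrix G' i y = connectionMatrix G i y + conformalShift G f i y
      + pderiv i f y • 1 := by
  have hdf := differentiableAt_of_contDiffOn hG.isOpen hf hy
  refine hG'.connectionMatrix_unique hy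
    (C := fun i => connectionMatrix G i y + conformalShift G f i y + pderiv i f y • 1)
    (fun i j k => ?_) (fun i => ?_) i
  · simp only [Matrix.add_apply, hG.connectionMatrix_comm hy i j k, hG.conformalShift_eq hy,
      Matrix.sub_apply, Matrix.vecMulVec_apply, coordCovector_apply, (hG.isSymm y hy).apply i j,
      Matrix.smul_apply, Matrix.one_apply, Pi.single_apply, differential, smul_eq_mul]
    ring
  · rw [pderiv_congr hG.isOpen hGG' hy, pderiv_smul (by fun_prop) (hG.differentiableAt hy),
      pderiv_exp_two_mul hdf, hG.pderiv_metric hy, hGG' y hy, Matrix.smul_mul,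
      Matrix.mul_add, Matrix.mul_add, hG.mul_conformalShift hy, Matrix.mul_smul, Matrix.mul_one,
      Matrix.transpose_smul, Matrix.transpose_add, Matrix.transpose_add,
      coordWedgeDifferential_transpose, Matrix.transpose_smul, hG.isSymm y hy]
    module

lemma covDeriv_coordCovector (hG : IsMetricOn G U) (hy : y ∈ U) (i j : Fin n) :
    covDeriv (connectionMatrix G) i (coordCovector G j) y
      = G y *ᵥ connectionMatrix G i y *ᵥ Pi.single j 1 := by
  have hderiv : pderiv i (coordCovector G j) y = pderiv i G y *ᵥ Pi.single j 1 := by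
    unfold coordCovector
    rw [pderiv_mulVec (hG.differentiableAt hy) (differentiableAt_const _), pderiv_const,
      Matrix.mulVec_zero, add_zero]
  rw [covDeriv, hderiv, hG.pderiv_metric hy, Matrix.transpose_mul, hG.isSymm y hy, coordCovector,
    Matrix.mulVec_mulVec, Matrix.mulVec_mulVec, Matrix.add_mulVec, add_sub_cancel_right]

lemma covDeriv_coordCovector_comm (hG : IsMetricOn G U) (hy : y ∈ U) (i j : Fin n) :
    covDeriv (connectionMatrix G) i (coordCovector G j) y
      = covDeriv (connectionMatrix G) j (coordCovector G i) y := by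
  rw [hG.covDeriv_coordCovector hy, hG.covDeriv_coordCovector hy]
  congr 1
  ext k
  simpa using hG.connectionMatrix_comm hy i j k

lemma mul_covDeriv_conformalShift (hG : IsMetricOn G U) (hf : ContDiffOn ℝ ∞ f U) (hy : y ∈ U)
    (i j : Fin n) :
    G y * (pderiv i (conformalShift G f j) y + (connectionMatrix G i y * conformalShift G f j y
        - conformalShift G f j y * connectionMatrix G i y))
      = Matrix.vecMulVec (covDeriv (connectionMatrix G) i (coordCovector G j) y) (differential f y)
        + Matrix.vecMulVec (coordCovector G j y) (hessian G f y i)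
        - (Matrix.vecMulVec (hessian G f y i) (coordCovector G j y)
          + Matrix.vecMulVec (differential f y)
            (covDeriv (connectionMatrix G) i (coordCovector G j) y)) := by
  have hγ := differentiableAt_of_contDiffOn hG.isOpen (hG.contDiffOn_coordCovector j) hy
  have hφ := differentiableAt_of_contDiffOn hG.isOpen (contDiffOn_differential hG.isOpen hf) hy
  have hlower : pderiv i (coordWedgeDifferential G f j) y
      = pderiv i G y * conformalShift G f j y + G y * pderiv i (conformalShift G f j) y := by
    rw [← pderiv_matrix_mul (hG.differentiableAt hy) (hG.differentiableAt_conformalShift hf hy j)]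
    exact pderiv_congr hG.isOpen (fun z hz => (hG.mul_conformalShift hz j).symm) hy i
  have hwedge : pderiv i (coordWedgeDifferential G f j) y
      = pderiv i (fun z => Matrix.vecMulVec (coordCovector G j z) (differential f z)) y
        - pderiv i (fun z => Matrix.vecMulVec (differential f z) (coordCovector G j z)) y :=
    pderiv_sub (differentiableAt_vecMulVec hγ hφ) (differentiableAt_vecMulVec hφ hγ) i
  have hleft := covDeriv_vecMulVec (θ := connectionMatrix G) hγ hφ i
  have hright := covDeriv_vecMulVec (θ := connectionMatrix G) hφ hγ i
  rw [hG.pderiv_metric hy, Matrix.transpose_mul, hG.isSymm y hy, Matrix.add_mul, Matrix.mul_assoc,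
    Matrix.mul_assoc, hG.mul_conformalShift hy] at hlower
  have hrow : hessian G f y i = covDeriv (connectionMatrix G) i (differential f) y := rfl
  rw [hrow, ← hleft, ← hright, Matrix.mul_add, Matrix.mul_sub,
    ← Matrix.mul_assoc (G y) (conformalShift G f j y), hG.mul_conformalShift hy,
    ← sub_eq_iff_eq_add'.2 hlower, hwedge, coordWedgeDifferential]
  noncomm_ring

lemma mul_conformalShift_mul_conformalShift (hG : IsMetricOn G U) (hy : y ∈ U) (i j : Fin n) :
    G y * (conformalShift G f i y * conformalShift G f j y)
      = differential f y j • Matrix.vecMulVec (coordCovector G i y) (differential f y)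
        - (differential f y ⬝ᵥ (G y)⁻¹ *ᵥ differential f y) •
          Matrix.vecMulVec (coordCovector G i y) (coordCovector G j y)
        - G y i j • Matrix.vecMulVec (differential f y) (differential f y)
        + differential f y i • Matrix.vecMulVec (differential f y) (coordCovector G j y) := by
  have hpair : coordCovector G i y ⬝ᵥ (G y)⁻¹ *ᵥ differential f y = differential f y i := by
    rw [Matrix.dotProduct_mulVec, ← Matrix.mulVec_transpose, hG.inv_isSymm hy,
      hG.inv_mulVec_coordCovector hy, single_one_dotProduct]
  rw [← Matrix.mul_assoc, hG.mul_conformalShift hy, hG.conformalShift_eq hy,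
    coordWedgeDifferential]
  simp only [Matrix.sub_mul, Matrix.mul_sub, Matrix.vecMulVec_mul_vecMulVec, hpair,
    Matrix.vecMulVec_smul, dotProduct_single, mul_one, coordCovector_apply,
    (hG.isSymm y hy).apply i j]
  module

lemma curvatureForm_conformal (hG : IsMetricOn G U) (hG' : IsMetricOn G' U)
    (hf : ContDiffOn ℝ ∞ f U) (hGG' : ∀ z ∈ U, G' z = Real.exp (2 * f z) • G z) (hy : y ∈ U)
    (i j : Fin n) :
    curvatureForm (connectionMatrix G') i j y
      = curvatureForm (connectionMatrix G) i j y + curvatureForm (conformalShift G f) i j y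
        + (connectionMatrix G i y * conformalShift G f j y
          - conformalShift G f j y * connectionMatrix G i y)
        - (connectionMatrix G j y * conformalShift G f i y
          - conformalShift G f i y * connectionMatrix G j y) := by
  have hθ := hG.differentiableAt_connectionMatrix hy
  have hK := hG.differentiableAt_conformalShift hf hy
  have hdf (i : Fin n) : DifferentiableAt ℝ (pderiv i f) y :=
    differentiableAt_of_contDiffOn hG.isOpen (contDiffOn_pderiv hG.isOpen hf i) hy
  rw [← curvatureForm_add hθ hK, ← curvatureForm_add_smul_one (fun i => (hθ i).fun_add (hK i)) hdf
    (pderiv_comm hG.isOpen hf hy i j)]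
  exact curvatureForm_congr hG.isOpen
    (fun i z hz => hG.connectionMatrix_conformal hG' hf hGG' hz i) hy i j

lemma riemann_conformal (hG : IsMetricOn G U) (hG' : IsMetricOn G' U)
    (hf : ContDiffOn ℝ ∞ f U) (hGG' : ∀ z ∈ U, G' z = Real.exp (2 * f z) • G z) (hy : y ∈ U)
    (i j k l : Fin n) :
    riemann G' i j k l y = Real.exp (2 * f y) *
      (riemann G i j k l y - kulkarniNomizu (schoutenShift G f y) (G y) i j k l) := by
  have hlower : G y * curvatureForm (connectionMatrix G') i j y
      = G y * curvatureForm (connectionMatrix G) i j y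
        + G y * (conformalShift G f i y * conformalShift G f j y)
        - G y * (conformalShift G f j y * conformalShift G f i y)
        + G y * (pderiv i (conformalShift G f j) y
          + (connectionMatrix G i y * conformalShift G f j y
            - conformalShift G f j y * connectionMatrix G i y))
        - G y * (pderiv j (conformalShift G f i) y
          + (connectionMatrix G j y * conformalShift G f i y
            - conformalShift G f i y * connectionMatrix G j y)) := by
    rw [hG.curvatureForm_conformal hG' hf hGG' hy, curvatureForm.eq_1 (conformalShift G f)]
    noncomm_ring
  rw [hG'.riemann_eq hy, hG.riemann_eq hy, hGG' y hy, Matrix.smul_mul, hlower,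
    hG.mul_covDeriv_conformalShift hf hy, hG.mul_covDeriv_conformalShift hf hy,
    hG.mul_conformalShift_mul_conformalShift hy, hG.mul_conformalShift_mul_conformalShift hy,
    hG.covDeriv_coordCovector_comm hy j i]
  simp only [Matrix.smul_apply, Matrix.add_apply, Matrix.sub_apply, Matrix.vecMulVec_apply,
    coordCovector_apply, smul_eq_mul, kulkarniNomizu, schoutenShift]
  have hsymm := (hG.isSymm y hy).apply
  rw [hsymm k i, hsymm k j, hsymm l i, hsymm l j, hsymm i j]
  ring

end IsMetricOn

end ConformalChange

section WeylTensor

variable {n : ℕ}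

/-- The matrix of components of the `2`-form `W(∂_i, ∂_j, ·, ·)`. -/
def weylMatrix (G : EuclideanSpace ℝ (Fin n) → Matrix (Fin n) (Fin n) ℝ)
    (y : EuclideanSpace ℝ (Fin n)) (i j : Fin n) : Matrix (Fin n) (Fin n) ℝ :=
  Matrix.of fun k l => weyl G i j k l y

variable {G G' : EuclideanSpace ℝ (Fin n) → Matrix (Fin n) (Fin n) ℝ}
  {f : EuclideanSpace ℝ (Fin n) → ℝ} {U : Set (EuclideanSpace ℝ (Fin n))}
  {y : EuclideanSpace ℝ (Fin n)}

lemma weylMatrix_swap (i j : Fin n) : weylMatrix G y j i = -weylMatrix G y i j := by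
  ext k l
  simp only [weylMatrix, Matrix.of_apply, Matrix.neg_apply, weyl, kulkarniNomizu, riemann_swap i j]
  ring

lemma trace_inv_mul_kulkarniNomizu {A T : Matrix (Fin n) (Fin n) ℝ} (hdet : IsUnit A.det)
    (i k : Fin n) :
    (A⁻¹ * Matrix.of fun j l => kulkarniNomizu T A i j k l).trace
      = ((n : ℝ) - 2) * T i k + (A⁻¹ * T).trace * A i k := by
  have hmatrix : (Matrix.of fun j l => kulkarniNomizu T A i j k l)
      = T i k • A + A i k • T - Matrix.vecMulVec (A *ᵥ Pi.single k 1) (T i)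
        - Matrix.vecMulVec (T *ᵥ Pi.single k 1) (A i) := by
    ext j l
    simp only [kulkarniNomizu, Matrix.of_apply, Matrix.sub_apply, Matrix.add_apply,
      Matrix.smul_apply, Matrix.vecMulVec_apply, Matrix.mulVec_single_one, Matrix.col_apply,
      smul_eq_mul]
    ring
  have hcancel (u : Fin n → ℝ) : A⁻¹ *ᵥ A *ᵥ u = u := by
    rw [Matrix.mulVec_mulVec, Matrix.nonsing_inv_mul _ hdet, Matrix.one_mulVec]
  have hrow : A⁻¹ *ᵥ T *ᵥ Pi.single k 1 ⬝ᵥ A i = T i k := by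
    rw [dotProduct_comm]
    change (A *ᵥ A⁻¹ *ᵥ T *ᵥ Pi.single k 1) i = T i k
    rw [Matrix.mulVec_mulVec, Matrix.mul_nonsing_inv _ hdet, Matrix.one_mulVec,
      Matrix.mulVec_single_one, Matrix.col_apply]
  rw [hmatrix]
  simp only [Matrix.mul_sub, Matrix.mul_add, Matrix.mul_smul, Matrix.trace_sub, Matrix.trace_add,
    Matrix.trace_smul, Matrix.mul_vecMulVec, Matrix.trace_vecMulVec, hcancel, hrow,
    Matrix.nonsing_inv_mul _ hdet, Matrix.trace_one, Fintype.card_fin, smul_eq_mul,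
    single_one_dotProduct]
  ring

namespace IsMetricOn

lemma ricci_eq_trace (hG : IsMetricOn G U) (hy : y ∈ U) (i k : Fin n) :
    ricci G i k y = ((G y)⁻¹ * Matrix.of fun j l => riemann G i j k l y).trace := by
  simp only [ricci, Matrix.trace, Matrix.diag, Matrix.mul_apply, Matrix.of_apply]
  rw [Finset.sum_comm]
  simp only [(hG.inv_isSymm hy).apply]

lemma scalarCurvature_eq_trace (hG : IsMetricOn G U) (hy : y ∈ U) :
    scalarCurvature G y = ((G y)⁻¹ * Matrix.of fun i k => ricci G i k y).trace := by
  simp only [scalarCurvature, Matrix.trace, Matrix.diag, Matrix.mul_apply, Matrix.of_apply]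
  rw [Finset.sum_comm]
  simp only [(hG.inv_isSymm hy).apply]

lemma inv_conformal (hG : IsMetricOn G U) (hGG' : ∀ z ∈ U, G' z = Real.exp (2 * f z) • G z)
    (hy : y ∈ U) : (G' y)⁻¹ = (Real.exp (2 * f y))⁻¹ • (G y)⁻¹ := by
  rw [hGG' y hy]
  exact Matrix.inv_smul' _ (Units.mk0 _ (Real.exp_ne_zero _)) (hG.isUnit_det y hy)

lemma ricci_conformal (hG : IsMetricOn G U) (hG' : IsMetricOn G' U)
    (hf : ContDiffOn ℝ ∞ f U) (hGG' : ∀ z ∈ U, G' z = Real.exp (2 * f z) • G z) (hy : y ∈ U)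
    (i k : Fin n) :
    ricci G' i k y = ricci G i k y - (((n : ℝ) - 2) * schoutenShift G f y i k
      + ((G y)⁻¹ * schoutenShift G f y).trace * G y i k) := by
  have hriemann : (Matrix.of fun j l => riemann G' i j k l y)
      = Real.exp (2 * f y) • ((Matrix.of fun j l => riemann G i j k l y)
        - Matrix.of fun j l => kulkarniNomizu (schoutenShift G f y) (G y) i j k l) := by
    ext j l
    exact hG.riemann_conformal hG' hf hGG' hy i j k l
  rw [hG'.ricci_eq_trace hy, hG.ricci_eq_trace hy, hriemann, hG.inv_conformal hGG' hy,
    Matrix.smul_mul, Matrix.mul_smul, inv_smul_smul₀ (Real.exp_ne_zero _), Matrix.mul_sub,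
    Matrix.trace_sub, trace_inv_mul_kulkarniNomizu (hG.isUnit_det y hy)]

lemma scalarCurvature_conformal (hG : IsMetricOn G U) (hG' : IsMetricOn G' U)
    (hf : ContDiffOn ℝ ∞ f U) (hGG' : ∀ z ∈ U, G' z = Real.exp (2 * f z) • G z) (hy : y ∈ U) :
    scalarCurvature G' y = (Real.exp (2 * f y))⁻¹ * (scalarCurvature G y
      - 2 * ((n : ℝ) - 1) * ((G y)⁻¹ * schoutenShift G f y).trace) := by
  have hricci : (Matrix.of fun i k => ricci G' i k y)
      = (Matrix.of fun i k => ricci G i k y) - (((n : ℝ) - 2) • schoutenShift G f y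
        + ((G y)⁻¹ * schoutenShift G f y).trace • G y) := by
    ext i k
    exact hG.ricci_conformal hG' hf hGG' hy i k
  rw [hG'.scalarCurvature_eq_trace hy, hG.scalarCurvature_eq_trace hy, hricci,
    hG.inv_conformal hGG' hy, Matrix.smul_mul, Matrix.trace_smul, Matrix.mul_sub, Matrix.mul_add,
    Matrix.mul_smul, Matrix.mul_smul, Matrix.nonsing_inv_mul _ (hG.isUnit_det y hy),
    Matrix.trace_sub, Matrix.trace_add, Matrix.trace_smul, Matrix.trace_smul, Matrix.trace_one,
    Fintype.card_fin, smul_eq_mul, smul_eq_mul, smul_eq_mul]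
  ring

lemma schouten_conformal (hn : 3 ≤ n) (hG : IsMetricOn G U) (hG' : IsMetricOn G' U)
    (hf : ContDiffOn ℝ ∞ f U) (hGG' : ∀ z ∈ U, G' z = Real.exp (2 * f z) • G z) (hy : y ∈ U)
    (i k : Fin n) :
    schouten G' i k y = schouten G i k y - schoutenShift G f y i k := by
  have hn' : (3 : ℝ) ≤ n := by exact_mod_cast hn
  have hn1 : (n : ℝ) - 1 ≠ 0 := by linarith
  have hn2 : (n : ℝ) - 2 ≠ 0 := by linarith
  rw [schouten, schouten, hG.ricci_conformal hG' hf hGG' hy,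
    hG.scalarCurvature_conformal hG' hf hGG' hy, hGG' y hy, Matrix.smul_apply, smul_eq_mul]
  field_simp
  ring

lemma weylMatrix_conformal (hn : 3 ≤ n) (hG : IsMetricOn G U) (hG' : IsMetricOn G' U)
    (hf : ContDiffOn ℝ ∞ f U) (hGG' : ∀ z ∈ U, G' z = Real.exp (2 * f z) • G z) (hy : y ∈ U)
    (i j : Fin n) : weylMatrix G' y i j = Real.exp (2 * f y) • weylMatrix G y i j := by
  ext k l
  simp only [weylMatrix, Matrix.of_apply, Matrix.smul_apply, smul_eq_mul, weyl, kulkarniNomizu,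
    hG.riemann_conformal hG' hf hGG' hy, hG.schouten_conformal hn hG' hf hGG' hy, hGG' y hy]
  ring

end IsMetricOn

end WeylTensor

section CurvatureNullity

variable {n : ℕ}

/-- The vector `v` lies in the nullity of the curvature tensor: `R(∂_i, ∂_j) v = 0` for all
`i, j`. -/
def IsCurvatureNull (G : EuclideanSpace ℝ (Fin n) → Matrix (Fin n) (Fin n) ℝ)
    (y : EuclideanSpace ℝ (Fin n)) (v : Fin n → ℝ) : Prop :=
  ∀ i j k, ∑ l, riemann G i j k l y * v l = 0

/-- The normalized scalar curvature `s / (2 (n - 1) (n - 2))`: as a curvature null vector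
annihilates the Ricci tensor, it satisfies `S v = -σ g v` for this number `σ`. -/
def normalizedScalar (G : EuclideanSpace ℝ (Fin n) → Matrix (Fin n) (Fin n) ℝ)
    (y : EuclideanSpace ℝ (Fin n)) : ℝ :=
  1 / ((n : ℝ) - 2) * (1 / (2 * ((n : ℝ) - 1)) * scalarCurvature G y)

/-- The symmetric form `σ g - S`, where `σ` is the normalized scalar curvature and `S` the
Schouten tensor. -/
def nullityForm (G : EuclideanSpace ℝ (Fin n) → Matrix (Fin n) (Fin n) ℝ)
    (y : EuclideanSpace ℝ (Fin n)) : Matrix (Fin n) (Fin n) ℝ :=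
  normalizedScalar G y • G y - Matrix.of fun i j => schouten G i j y

variable {G : EuclideanSpace ℝ (Fin n) → Matrix (Fin n) (Fin n) ℝ}
  {U : Set (EuclideanSpace ℝ (Fin n))} {y : EuclideanSpace ℝ (Fin n)} {v : Fin n → ℝ}

lemma sum_smul_vecMulVec (v w : Fin n → ℝ) (A B : Matrix (Fin n) (Fin n) ℝ) :
    ∑ i, ∑ j, (v i * w j) • Matrix.vecMulVec (A i) (B j)
      = Matrix.vecMulVec (v ᵥ* A) (w ᵥ* B) := by
  ext k l
  simp only [Matrix.sum_apply, Matrix.smul_apply, Matrix.vecMulVec_apply, Matrix.vecMul,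
    dotProduct, smul_eq_mul, Finset.sum_mul_sum]
  exact Finset.sum_congr rfl fun i _ => Finset.sum_congr rfl fun j _ => by ring

lemma sum_smul_vecMulVec_swap (v w : Fin n → ℝ) (A B : Matrix (Fin n) (Fin n) ℝ) :
    ∑ i, ∑ j, (v i * w j) • Matrix.vecMulVec (A j) (B i)
      = Matrix.vecMulVec (w ᵥ* A) (v ᵥ* B) := by
  rw [Finset.sum_comm, ← sum_smul_vecMulVec]
  simp only [mul_comm]

lemma IsMetricOn.nullityForm_isSymm (hG : IsMetricOn G U) (hy : y ∈ U) :
    (nullityForm G y).IsSymm :=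
  ((hG.isSymm y hy).smul _).sub (Matrix.IsSymm.ext fun i j => hG.schouten_symm hy j i)

namespace IsCurvatureNull

lemma sum_mul_riemann (hv : IsCurvatureNull G y v) (hG : IsMetricOn G U) (hy : y ∈ U)
    (j k l : Fin n) : ∑ i, v i * riemann G i j k l y = 0 := by
  rw [← neg_eq_zero, ← Finset.sum_neg_distrib, ← hv k l j]
  refine Finset.sum_congr rfl fun i _ => ?_
  rw [hG.riemann_pair_symm hy k l j i, riemann_swap i j]
  ring

lemma vecMul_ricci (hv : IsCurvatureNull G y v) (hG : IsMetricOn G U) (hy : y ∈ U) :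
    v ᵥ* (Matrix.of fun i k => ricci G i k y) = 0 := by
  ext k
  calc ∑ i, v i * ricci G i k y
      = ∑ j, ∑ l, (G y)⁻¹ j l * ∑ i, v i * riemann G i j k l y := by
        simp only [ricci, Finset.mul_sum, mul_left_comm (v _)]
        rw [Finset.sum_comm]
        exact Finset.sum_congr rfl fun j _ => Finset.sum_comm
    _ = 0 := by simp only [hv.sum_mul_riemann hG hy, mul_zero, Finset.sum_const_zero]

lemma vecMul_schouten (hv : IsCurvatureNull G y v) (hG : IsMetricOn G U) (hy : y ∈ U) :
    v ᵥ* (Matrix.of fun i k => schouten G i k y) = -(normalizedScalar G y • v ᵥ* G y) := by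
  have hschouten : (Matrix.of fun i k => schouten G i k y)
      = (1 / ((n : ℝ) - 2)) • (Matrix.of fun i k => ricci G i k y)
        - normalizedScalar G y • G y := by
    ext i k
    simp only [schouten, normalizedScalar, Matrix.of_apply, Matrix.sub_apply, Matrix.smul_apply,
      smul_eq_mul]
    ring
  rw [hschouten, Matrix.vecMul_sub, Matrix.vecMul_smul, Matrix.vecMul_smul, hv.vecMul_ricci hG hy,
    smul_zero, zero_sub]

lemma vecMul_nullityForm (hv : IsCurvatureNull G y v) (hG : IsMetricOn G U) (hy : y ∈ U) :
    v ᵥ* nullityForm G y = (2 * normalizedScalar G y) • v ᵥ* G y := by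
  rw [nullityForm, Matrix.vecMul_sub, Matrix.vecMul_smul, hv.vecMul_schouten hG hy]
  module

lemma sum_smul_weylMatrix (hv : IsCurvatureNull G y v) (hG : IsMetricOn G U) (hy : y ∈ U)
    (w : Fin n → ℝ) :
    ∑ i, ∑ j, (v i * w j) • weylMatrix G y i j
      = Matrix.vecMulVec (v ᵥ* G y) (w ᵥ* nullityForm G y)
        - Matrix.vecMulVec (w ᵥ* nullityForm G y) (v ᵥ* G y) := by
  set S : Matrix (Fin n) (Fin n) ℝ := Matrix.of fun i k => schouten G i k y with hS
  have hriemann : ∑ i, ∑ j, (v i * w j) • (Matrix.of fun k l => riemann G i j k l y) = 0 := by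
    ext k l
    simp only [Matrix.sum_apply, Matrix.smul_apply, Matrix.of_apply, smul_eq_mul,
      Matrix.zero_apply]
    rw [Finset.sum_comm]
    simp only [mul_right_comm _ (w _), ← Finset.sum_mul, hv.sum_mul_riemann hG hy, zero_mul,
      Finset.sum_const_zero]
  have hweyl (i j : Fin n) : weylMatrix G y i j = (Matrix.of fun k l => riemann G i j k l y)
      - (Matrix.vecMulVec (S i) (G y j) + Matrix.vecMulVec (G y i) (S j)
        - Matrix.vecMulVec (G y j) (S i) - Matrix.vecMulVec (S j) (G y i)) := by
    ext k l
    simp only [weylMatrix, weyl, kulkarniNomizu, hS, Matrix.of_apply, Matrix.sub_apply,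
      Matrix.add_apply, Matrix.vecMulVec_apply]
    ring
  simp only [hweyl, smul_sub, smul_add, Finset.sum_sub_distrib, Finset.sum_add_distrib, hriemann,
    sum_smul_vecMulVec, sum_smul_vecMulVec_swap]
  rw [hv.vecMul_schouten hG hy, nullityForm, Matrix.vecMul_sub, Matrix.vecMul_smul]
  simp only [Matrix.neg_vecMulVec, Matrix.vecMulVec_neg, Matrix.smul_vecMulVec,
    Matrix.vecMulVec_smul, Matrix.sub_vecMulVec, Matrix.vecMulVec_sub]
  module

end IsCurvatureNull

end CurvatureNullity

section Charts

variable {n : ℕ} {M : Type*} [TopologicalSpace M] [ChartedSpace (EuclideanSpace ℝ (Fin n)) M]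

lemma mfderiv_extChartAt_symm_eq_sum (p : M) (y u : EuclideanSpace ℝ (Fin n)) :
    mfderiv 𝓘(ℝ, EuclideanSpace ℝ (Fin n)) (𝓡 n) (extChartAt (𝓡 n) p).symm y u
      = ∑ k, u k • coordField p k y := by
  conv_lhs => rw [euclideanSpace_eq_sum u]
  exact (map_sum _ _ _).trans (Finset.sum_congr rfl fun k _ => map_smul _ _ _)

/-- The tangent space at `p` identified with `ℝⁿ` by components in the preferred chart. -/
def tangentCoords (p : M) : TangentSpace (𝓡 n) p ≃ₗ[ℝ] (Fin n → ℝ) :=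
  WithLp.linearEquiv 2 ℝ (Fin n → ℝ)

/-- The vector of components of the field `X` in the preferred chart around `p`. -/
def fieldCoords (X : ∀ q : M, TangentSpace (𝓡 n) q) (p : M) (y : EuclideanSpace ℝ (Fin n)) :
    Fin n → ℝ :=
  fun k => fieldInChart X p k y

variable [IsManifold (𝓡 n) ∞ M]

lemma isInvertible_mfderiv_extChartAt_symm (p : M) {y : EuclideanSpace ℝ (Fin n)}
    (hy : y ∈ (extChartAt (𝓡 n) p).target) :
    (mfderiv 𝓘(ℝ, EuclideanSpace ℝ (Fin n)) (𝓡 n) (extChartAt (𝓡 n) p).symm y).IsInvertible := by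
  have : IsManifold (𝓡 n) 1 M := .of_le (n := ∞) (by simp)
  simpa only [modelWithCornersSelf_coe, Set.range_id, mfderivWithin_univ]
    using isInvertible_mfderivWithin_extChartAt_symm (I := 𝓡 n) hy

lemma mfderiv_extChartAt_symm_mfderiv_extChartAt (p : M) {y : EuclideanSpace ℝ (Fin n)}
    (hy : y ∈ (extChartAt (𝓡 n) p).target)
    (v : TangentSpace (𝓡 n) ((extChartAt (𝓡 n) p).symm y)) :
    mfderiv 𝓘(ℝ, EuclideanSpace ℝ (Fin n)) (𝓡 n) (extChartAt (𝓡 n) p).symm y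
      (mfderiv (𝓡 n) 𝓘(ℝ, EuclideanSpace ℝ (Fin n)) (extChartAt (𝓡 n) p)
        ((extChartAt (𝓡 n) p).symm y) v) = v := by
  have : IsManifold (𝓡 n) 1 M := .of_le (n := ∞) (by simp)
  have h := mfderivWithin_extChartAt_symm_comp_mfderiv_extChartAt (I := 𝓡 n) hy
  simp only [modelWithCornersSelf_coe, Set.range_id, mfderivWithin_univ] at h
  exact congrArg (fun L => L v) h

lemma mfderiv_extChartAt_symm_self (p : M) :
    mfderiv 𝓘(ℝ, EuclideanSpace ℝ (Fin n)) (𝓡 n) (extChartAt (𝓡 n) p).symm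
      (extChartAt (𝓡 n) p p) = ContinuousLinearMap.id ℝ (EuclideanSpace ℝ (Fin n)) := by
  have : IsManifold (𝓡 n) 1 M := .of_le (n := ∞) (by simp)
  have h := mfderivWithin_range_extChartAt_symm (I := 𝓡 n) (x := p)
  simp only [modelWithCornersSelf_coe, Set.range_id, mfderivWithin_univ] at h
  exact h

lemma inner_mfderiv_extChartAt_symm (g : SmoothMetric n M) (p : M)
    (y u w : EuclideanSpace ℝ (Fin n)) :
    g.inner ((extChartAt (𝓡 n) p).symm y)
      (mfderiv 𝓘(ℝ, EuclideanSpace ℝ (Fin n)) (𝓡 n) (extChartAt (𝓡 n) p).symm y u)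
      (mfderiv 𝓘(ℝ, EuclideanSpace ℝ (Fin n)) (𝓡 n) (extChartAt (𝓡 n) p).symm y w)
      = u.ofLp ⬝ᵥ metricInChart g p y *ᵥ w.ofLp := by
  rw [mfderiv_extChartAt_symm_eq_sum, mfderiv_extChartAt_symm_eq_sum]
  simp only [map_sum, map_smul, sum_apply, smul_apply, smul_eq_mul, dotProduct, Matrix.mulVec,
    metricInChart, Matrix.of_apply, Finset.mul_sum]
  rw [Finset.sum_comm]
  exact Finset.sum_congr rfl fun i _ => Finset.sum_congr rfl fun j _ => by ring

lemma inner_eq_dotProduct (g : SmoothMetric n M) (p : M) (v w : TangentSpace (𝓡 n) p) :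
    g.inner p v w
      = tangentCoords p v ⬝ᵥ metricInChart g p (extChartAt (𝓡 n) p p) *ᵥ tangentCoords p w := by
  have h := inner_mfderiv_extChartAt_symm g p (extChartAt (𝓡 n) p p) v w
  rw [mfderiv_extChartAt_symm_self] at h
  have htransport (q : M) (hq : q = p) : g.inner q v w = g.inner p v w := by rw [hq]
  exact (htransport _ (extChartAt_to_inv (I := 𝓡 n) p)).symm.trans h

lemma inner_field_eq_dotProduct (g : SmoothMetric n M) (X : ∀ q : M, TangentSpace (𝓡 n) q)
    (p : M) {y : EuclideanSpace ℝ (Fin n)} (hy : y ∈ (extChartAt (𝓡 n) p).target) :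
    g.inner ((extChartAt (𝓡 n) p).symm y) (X ((extChartAt (𝓡 n) p).symm y))
        (X ((extChartAt (𝓡 n) p).symm y))
      = fieldCoords X p y ⬝ᵥ metricInChart g p y *ᵥ fieldCoords X p y := by
  set u : EuclideanSpace ℝ (Fin n) := mfderiv (𝓡 n) 𝓘(ℝ, EuclideanSpace ℝ (Fin n))
    (extChartAt (𝓡 n) p) ((extChartAt (𝓡 n) p).symm y) (X ((extChartAt (𝓡 n) p).symm y)) with hu
  have h := inner_mfderiv_extChartAt_symm g p y u u
  rwa [hu, mfderiv_extChartAt_symm_mfderiv_extChartAt p hy] at h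

lemma fieldCoords_self (X : ∀ q : M, TangentSpace (𝓡 n) q) (p : M) :
    fieldCoords X p (extChartAt (𝓡 n) p p) = tangentCoords p (X p) := by
  have : IsManifold (𝓡 n) 1 M := .of_le (n := ∞) (by simp)
  have htransport (q : M) (hq : q = p) :
      (fun k => (EuclideanSpace.proj k : EuclideanSpace ℝ (Fin n) →L[ℝ] ℝ)
        (mfderiv (𝓡 n) 𝓘(ℝ, EuclideanSpace ℝ (Fin n)) (extChartAt (𝓡 n) p) q (X q)))
        = tangentCoords p (X p) := by
    subst hq
    rw [mfderiv_extChartAt_self]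
    rfl
  exact htransport _ (extChartAt_to_inv (I := 𝓡 n) p)

lemma isUnit_det_metricInChart (g : SmoothMetric n M) (p : M) {y : EuclideanSpace ℝ (Fin n)}
    (hy : y ∈ (extChartAt (𝓡 n) p).target) : IsUnit (metricInChart g p y).det := by
  rw [isUnit_iff_ne_zero]
  intro hdet
  obtain ⟨c, hc, hGc⟩ := Matrix.exists_mulVec_eq_zero_iff.mpr hdet
  have hne : mfderiv 𝓘(ℝ, EuclideanSpace ℝ (Fin n)) (𝓡 n) (extChartAt (𝓡 n) p).symm y
      (WithLp.toLp 2 c : EuclideanSpace ℝ (Fin n)) ≠ 0 := fun h =>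
    hc (congrArg WithLp.ofLp ((isInvertible_mfderiv_extChartAt_symm p hy).injective
      (h.trans (map_zero _).symm)))
  have hpos := g.pos _ _ hne
  rw [inner_mfderiv_extChartAt_symm, hGc, dotProduct_zero] at hpos
  exact hpos.false

lemma contMDiffOn_coordField (p : M) (i : Fin n) :
    ContMDiffOn 𝓘(ℝ, EuclideanSpace ℝ (Fin n)) (𝓡 n).tangent ∞
      (fun y => (⟨(extChartAt (𝓡 n) p).symm y, coordField p i y⟩ : TangentBundle (𝓡 n) M))
      (extChartAt (𝓡 n) p).target := by
  have : IsManifold (𝓡 n) 1 M := .of_le (n := ∞) (by simp)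
  have hopen := isOpen_extChartAt_target (I := 𝓡 n) p
  have htangent := (contMDiffOn_extChartAt_symm (I := 𝓡 n) (n := ∞)
    p).contMDiffOn_tangentMapWithin (m := ∞) le_rfl hopen.uniqueMDiffOn
  have hconst : ContMDiffOn 𝓘(ℝ, EuclideanSpace ℝ (Fin n))
      𝓘(ℝ, EuclideanSpace ℝ (Fin n)).tangent ∞
      (fun y => (⟨y, EuclideanSpace.single i 1⟩ :
        TangentBundle 𝓘(ℝ, EuclideanSpace ℝ (Fin n)) (EuclideanSpace ℝ (Fin n))))
      (extChartAt (𝓡 n) p).target :=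
    contMDiffOn_vectorSpace_iff_contDiffOn.mpr contDiffOn_const
  refine (htangent.comp hconst fun y hy => hy).congr fun y hy => ?_
  simp only [Function.comp, tangentMapWithin, coordField]
  rw [mfderivWithin_of_isOpen hopen hy]

lemma contDiffOn_metricInChart (g : SmoothMetric n M) (p : M) :
    ContDiffOn ℝ ∞ (metricInChart g p) (extChartAt (𝓡 n) p).target := by
  refine contDiffOn_matrix.mpr fun i j => contMDiffOn_iff_contDiffOn.mp fun y hy => ?_
  have htotal : ContMDiffWithinAt 𝓘(ℝ, EuclideanSpace ℝ (Fin n)) ((𝓡 n).prod 𝓘(ℝ)) ∞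
      (fun y ↦ Bundle.TotalSpace.mk' ℝ (E := Bundle.Trivial M ℝ) ((extChartAt (𝓡 n) p).symm y)
        (metricInChart g p y i j)) (extChartAt (𝓡 n) p).target y :=
    .clm_bundle_apply₂ (F₁ := EuclideanSpace ℝ (Fin n)) (F₂ := EuclideanSpace ℝ (Fin n))
      (g.contMDiff.contMDiffAt.comp_contMDiffWithinAt y (contMDiffOn_extChartAt_symm p y hy))
      (contMDiffOn_coordField p i y hy) (contMDiffOn_coordField p j y hy)
  exact (Bundle.contMDiffWithinAt_totalSpace.mp htotal).2

lemma isMetricOn_metricInChart (g : SmoothMetric n M) (p : M) :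
    IsMetricOn (metricInChart g p) (extChartAt (𝓡 n) p).target where
  isOpen := isOpen_extChartAt_target p
  contDiffOn := contDiffOn_metricInChart g p
  isSymm _ _ := Matrix.IsSymm.ext fun _ _ => g.symm _ _ _
  isUnit_det _ hy := isUnit_det_metricInChart g p hy

lemma IsSmoothVectorField.contDiffOn_fieldCoords {X : ∀ q : M, TangentSpace (𝓡 n) q}
    (hX : IsSmoothVectorField X) (p : M) :
    ContDiffOn ℝ ∞ (fieldCoords X p) (extChartAt (𝓡 n) p).target := by
  have : IsManifold (𝓡 n) 1 M := .of_le (n := ∞) (by simp)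
  have hopen := (chartAt (EuclideanSpace ℝ (Fin n)) p).open_source
  have hmaps : Set.MapsTo (extChartAt (𝓡 n) p).symm (extChartAt (𝓡 n) p).target
      (chartAt (EuclideanSpace ℝ (Fin n)) p).source := fun y hy =>
    extChartAt_source (𝓡 n) p ▸ (extChartAt (𝓡 n) p).map_target hy
  have htangent := (contMDiffOn_extChartAt (I := 𝓡 n) (n := ∞)
    (x := p)).contMDiffOn_tangentMapWithin (m := ∞) le_rfl hopen.uniqueMDiffOn
  have hfield := (contMDiff_snd_tangentBundle_modelSpace (n := ∞) (EuclideanSpace ℝ (Fin n))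
    𝓘(ℝ, EuclideanSpace ℝ (Fin n))).comp_contMDiffOn
      (htangent.comp (hX.comp_contMDiffOn (contMDiffOn_extChartAt_symm p)) hmaps)
  refine contDiffOn_pi.mpr fun k => ((EuclideanSpace.proj k :
    EuclideanSpace ℝ (Fin n) →L[ℝ] ℝ).contDiff.comp_contDiffOn
      (contMDiffOn_iff_contDiffOn.mp hfield)).congr fun y hy => ?_
  simp only [Function.comp, tangentMapWithin, fieldCoords, fieldInChart]
  rw [mfderivWithin_of_isOpen hopen (hmaps hy)]

end Charts

section ParallelVectorFields

variable {n : ℕ} {M : Type*} [TopologicalSpace M] [ChartedSpace (EuclideanSpace ℝ (Fin n)) M]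
  [IsManifold (𝓡 n) ∞ M] {g : SmoothMetric n M} {X : ∀ q : M, TangentSpace (𝓡 n) q}

namespace IsParallel

lemma pderiv_fieldCoords (hpar : IsParallel g X) (hX : IsSmoothVectorField X) (p : M)
    {y : EuclideanSpace ℝ (Fin n)} (hy : y ∈ (extChartAt (𝓡 n) p).target) (i : Fin n) :
    pderiv i (fieldCoords X p) y
      = -(connectionMatrix (metricInChart g p) i y *ᵥ fieldCoords X p y) := by
  ext k
  have hcomponent : pderiv i (fieldCoords X p) y k = partialDeriv i (fieldInChart X p k) y :=
    (pderiv_linearMap (LinearMap.proj k) (differentiableAt_of_contDiffOn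
      (isOpen_extChartAt_target p) (hX.contDiffOn_fieldCoords p) hy) i).symm
  rw [hcomponent]
  exact eq_neg_of_add_eq_zero_left (hpar p y hy i k)

lemma eventually_inner_eq (hpar : IsParallel g X) (hX : IsSmoothVectorField X) (p : M) :
    ∀ᶠ q in nhds p, g.inner q (X q) (X q) = g.inner p (X p) (X p) := by
  set G := metricInChart g p
  set φ := extChartAt (𝓡 n) p
  have hG : IsMetricOn G φ.target := isMetricOn_metricInChart g p
  have hXd (z : EuclideanSpace ℝ (Fin n)) (hz : z ∈ φ.target) :
      DifferentiableAt ℝ (fieldCoords X p) z :=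
    differentiableAt_of_contDiffOn hG.isOpen (hX.contDiffOn_fieldCoords p) hz
  set N : EuclideanSpace ℝ (Fin n) → ℝ := fun z => fieldCoords X p z ⬝ᵥ G z *ᵥ fieldCoords X p z
  obtain ⟨ε, hε, hball⟩ := Metric.isOpen_iff.mp hG.isOpen _ (mem_extChartAt_target (I := 𝓡 n) p)
  have hconst {z : EuclideanSpace ℝ (Fin n)} (hz : z ∈ Metric.ball (φ p) ε) : N z = N (φ p) := by
    refine Metric.isOpen_ball.is_const_of_fderiv_eq_zero (𝕜 := ℝ)
      (convex_ball _ _).isPreconnected (fun w hw => DifferentiableAt.differentiableWithinAt ?_)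
      (fun w hw => fderiv_eq_zero_of_pderiv_eq_zero fun i => ?_) hz (Metric.mem_ball_self hε)
    · exact differentiableAt_dotProduct (hXd w (hball hw))
        (differentiableAt_mulVec (hG.differentiableAt (hball hw)) (hXd w (hball hw)))
    · exact hG.pderiv_normSq_eq_zero (hXd w (hball hw)) (hball hw) i
        (hpar.pderiv_fieldCoords hX p (hball hw) i)
  have hN {q : M} (hq : q ∈ φ.source) : g.inner q (X q) (X q) = N (φ q) := by
    have h := inner_field_eq_dotProduct g X p (φ.map_source hq)
    rwa [φ.left_inv hq] at h
  filter_upwards [(continuousAt_extChartAt (I := 𝓡 n) p).eventually (Metric.ball_mem_nhds _ hε),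
    extChartAt_source_mem_nhds (I := 𝓡 n) p] with q hq hqs
  rw [hN hqs, hN (mem_extChartAt_source (I := 𝓡 n) p), hconst hq]

lemma ne_zero (hpar : IsParallel g X) (hX : IsSmoothVectorField X) {p q : M}
    (hq : q ∈ connectedComponent p) (hXq : X q ≠ 0) : X p ≠ 0 := by
  intro hXp
  have hconst := ((IsLocallyConstant.iff_eventually_eq _).mpr
    (hpar.eventually_inner_eq hX)).apply_eq_of_isPreconnected
    isPreconnected_connectedComponent hq (mem_connectedComponent (x := p))
  simp only [hXp, map_zero] at hconst
  exact (g.pos q _ hXq).ne' hconst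

lemma isCurvatureNull (hpar : IsParallel g X) (hX : IsSmoothVectorField X) (p : M) :
    IsCurvatureNull (metricInChart g p) (extChartAt (𝓡 n) p p) (tangentCoords p (X p)) := by
  rw [← fieldCoords_self]
  exact (isMetricOn_metricInChart g p).sum_riemann_mul_eq_zero (hX.contDiffOn_fieldCoords p)
    (fun _ hz => hpar.pderiv_fieldCoords hX p hz) (mem_extChartAt_target p)

end IsParallel

lemma AdmitsParallelField.exists_isCurvatureNull (h : AdmitsParallelField g) (p : M) :
    ∃ v : TangentSpace (𝓡 n) p, v ≠ 0 ∧
      IsCurvatureNull (metricInChart g p) (extChartAt (𝓡 n) p p) (tangentCoords p v) := by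
  obtain ⟨X, hX, hpar, hne⟩ := h
  obtain ⟨q, hq, hXq⟩ := hne p
  exact ⟨X p, hpar.ne_zero hX hq hXq, hpar.isCurvatureNull hX p⟩

end ParallelVectorFields

section Bivectors

variable {n : ℕ} {M : Type*} [TopologicalSpace M] [ChartedSpace (EuclideanSpace ℝ (Fin n)) M]
  {p : M}

lemma wedge_swap (v w : TangentSpace (𝓡 n) p) : wedge w v = -wedge v w := by
  unfold wedge
  rw [← AlternatingMap.map_swap _ _ (zero_ne_one (α := Fin 2))]
  congr 1
  ext i
  fin_cases i <;> rfl

variable (p) in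
/-- The wedge product as a bilinear map. -/
def wedgeBilin : TangentSpace (𝓡 n) p →ₗ[ℝ] TangentSpace (𝓡 n) p →ₗ[ℝ] Bivector n p :=
  have hadd (u v w : TangentSpace (𝓡 n) p) : wedge (u + v) w = wedge u w + wedge v w :=
    AlternatingMap.map_vecCons_add _ _ _ _
  have hsmul (c : ℝ) (v w : TangentSpace (𝓡 n) p) : wedge (c • v) w = c • wedge v w :=
    AlternatingMap.map_vecCons_smul _ _ _ _
  LinearMap.mk₂ ℝ wedge hadd hsmul
    (fun u v w => by rw [wedge_swap, hadd, wedge_swap v u, wedge_swap w u, neg_add])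
    (fun c v w => by rw [wedge_swap, hsmul, wedge_swap v w, smul_neg, neg_neg])

lemma wedge_eq_sum (v w : TangentSpace (𝓡 n) p) :
    wedge v w = ∑ k, ∑ l, (tangentCoords p v k * tangentCoords p w l) •
      wedge (tangentBasis n p k) (tangentBasis n p l) := by
  have hsum (u : TangentSpace (𝓡 n) p) : u = ∑ k, tangentCoords p u k • tangentBasis n p k :=
    euclideanSpace_eq_sum u
  change wedgeBilin p v w = _
  conv_lhs => rw [hsum v, hsum w]
  simp only [map_sum, map_smul, LinearMap.sum_apply, LinearMap.smul_apply, Finset.smul_sum,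
    smul_smul]
  rw [Finset.sum_comm]
  exact Finset.sum_congr rfl fun k _ => Finset.sum_congr rfl fun l _ =>
    congrArg (· • _) (mul_comm _ _)

variable (p) in
/-- The bivector `∑ m^{kl} ∂_k ∧ ∂_l`. The matrix `m` need not be skew-symmetric. -/
def bivectorOfMatrix : Matrix (Fin n) (Fin n) ℝ →ₗ[ℝ] Bivector n p :=
  ∑ k, ∑ l, (Matrix.entryLinearMap ℝ ℝ k l).smulRight
    (wedge (tangentBasis n p k) (tangentBasis n p l))

lemma bivectorOfMatrix_apply (m : Matrix (Fin n) (Fin n) ℝ) :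
    bivectorOfMatrix p m = ∑ k, ∑ l, m k l • wedge (tangentBasis n p k) (tangentBasis n p l) := by
  simp only [bivectorOfMatrix, LinearMap.sum_apply, LinearMap.smulRight_apply,
    Matrix.entryLinearMap_apply]

lemma bivectorOfMatrix_vecMulVec (v w : TangentSpace (𝓡 n) p) :
    bivectorOfMatrix p (Matrix.vecMulVec (tangentCoords p v) (tangentCoords p w)) = wedge v w := by
  simp only [bivectorOfMatrix_apply, Matrix.vecMulVec_apply, wedge_eq_sum v w]

lemma bivectorCoord_wedge (i j : Fin n) (v w : TangentSpace (𝓡 n) p) :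
    bivectorCoord n p i j (wedge v w)
      = tangentCoords p v i * tangentCoords p w j - tangentCoords p v j * tangentCoords p w i := by
  unfold bivectorCoord wedge
  rw [exteriorPower.pairingDual_ιMulti_ιMulti, Matrix.det_fin_two]
  rfl

lemma exists_eq_smul_of_wedge_eq_zero {v w : TangentSpace (𝓡 n) p} (hv : v ≠ 0)
    (h : wedge v w = 0) : ∃ c : ℝ, w = c • v := by
  obtain ⟨i, hi⟩ : ∃ i, tangentCoords p v i ≠ 0 :=
    Function.ne_iff.mp ((tangentCoords p).map_ne_zero_iff.mpr hv)
  refine ⟨tangentCoords p w i / tangentCoords p v i, (tangentCoords p).injective ?_⟩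
  ext j
  have hij := bivectorCoord_wedge i j v w
  rw [h, map_zero] at hij
  rw [map_smul, Pi.smul_apply, smul_eq_mul, div_mul_eq_mul_div, eq_div_iff hi]
  linarith

end Bivectors

section WeylOperator

variable {n : ℕ} {M : Type*} [TopologicalSpace M] [ChartedSpace (EuclideanSpace ℝ (Fin n)) M]
  [IsManifold (𝓡 n) ∞ M]

lemma weylOperator_apply (g : SmoothMetric n M) (p : M) (b : Bivector n p) :
    weylOperator g p b = (1 / 4 : ℝ) • bivectorOfMatrix p ((inverseMetricAt g p)ᵀ
      * (∑ i, ∑ j, bivectorCoord n p i j b •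
          weylMatrix (metricInChart g p) (extChartAt (𝓡 n) p p) i j)
      * inverseMetricAt g p) := by
  have hentry (i j k l : Fin n) : ∑ a, ∑ c, weylAt g p i j a c * inverseMetricAt g p a k
        * inverseMetricAt g p c l
      = ((inverseMetricAt g p)ᵀ * weylMatrix (metricInChart g p) (extChartAt (𝓡 n) p p) i j
        * inverseMetricAt g p) k l := by
    simp only [Matrix.mul_apply, Matrix.transpose_apply, Finset.sum_mul]
    rw [Finset.sum_comm]
    exact Finset.sum_congr rfl fun c _ => Finset.sum_congr rfl fun a _ => by
      rw [mul_comm (inverseMetricAt g p a k)]; rfl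
  simp only [weylOperator, LinearMap.sum_apply, LinearMap.smul_apply, LinearMap.smulRight_apply,
    hentry, Matrix.mul_sum, Matrix.sum_mul, map_sum, Matrix.mul_smul, Matrix.smul_mul, map_smul,
    bivectorOfMatrix_apply, Finset.smul_sum, smul_smul]
  exact Finset.sum_congr rfl fun i _ => Finset.sum_congr rfl fun j _ =>
    Finset.sum_congr rfl fun k _ => Finset.sum_congr rfl fun l _ => by ring_nf

lemma weylOperator_wedge_eq_sum (g : SmoothMetric n M) (p : M) (v w : TangentSpace (𝓡 n) p) :
    weylOperator g p (wedge v w) = (1 / 2 : ℝ) • bivectorOfMatrix p ((inverseMetricAt g p)ᵀ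
      * (∑ i, ∑ j, (tangentCoords p v i * tangentCoords p w j) •
          weylMatrix (metricInChart g p) (extChartAt (𝓡 n) p p) i j)
      * inverseMetricAt g p) := by
  set W := weylMatrix (metricInChart g p) (extChartAt (𝓡 n) p p)
  have hskew : ∑ i, ∑ j, (tangentCoords p v j * tangentCoords p w i) • W i j
      = -∑ i, ∑ j, (tangentCoords p v i * tangentCoords p w j) • W i j := by
    rw [Finset.sum_comm]
    simp only [W, ← Finset.sum_neg_distrib, ← smul_neg, ← weylMatrix_swap]
  rw [weylOperator_apply]
  simp only [bivectorCoord_wedge, sub_smul, Finset.sum_sub_distrib]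
  rw [hskew, sub_neg_eq_add, ← two_smul ℝ, Matrix.mul_smul, Matrix.smul_mul, map_smul, smul_smul,
    show (1 / 4 : ℝ) * 2 = 1 / 2 by norm_num]

/-- The endomorphism `E = g⁻¹ (σ g - S)` of the tangent space at `p` through which the Weyl
operator acts on `v ∧ T_p M` when `v` is curvature null: `W (v ∧ w) = v ∧ E w`. -/
def nullityEndomorphism (g : SmoothMetric n M) (p : M) : Module.End ℝ (TangentSpace (𝓡 n) p) :=
  (tangentCoords p).symm.conj
    (nullityForm (metricInChart g p) (extChartAt (𝓡 n) p p) * inverseMetricAt g p).vecMulLinear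

variable {g : SmoothMetric n M} {p : M} {v : TangentSpace (𝓡 n) p}

lemma tangentCoords_nullityEndomorphism (w : TangentSpace (𝓡 n) p) :
    tangentCoords p (nullityEndomorphism g p w)
      = tangentCoords p w ᵥ* nullityForm (metricInChart g p) (extChartAt (𝓡 n) p p)
        ᵥ* inverseMetricAt g p := by
  simp only [nullityEndomorphism, LinearEquiv.conj_apply_apply, LinearEquiv.symm_symm,
    LinearEquiv.apply_symm_apply, Matrix.vecMulLinear_apply, Matrix.vecMul_vecMul]

lemma inner_nullityEndomorphism (w z : TangentSpace (𝓡 n) p) :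
    g.inner p (nullityEndomorphism g p w) z = tangentCoords p w
      ⬝ᵥ nullityForm (metricInChart g p) (extChartAt (𝓡 n) p p) *ᵥ tangentCoords p z := by
  rw [inner_eq_dotProduct, tangentCoords_nullityEndomorphism, inverseMetricAt,
    Matrix.dotProduct_mulVec, Matrix.vecMul_vecMul,
    Matrix.nonsing_inv_mul _ (isUnit_det_metricInChart g p (mem_extChartAt_target p)),
    Matrix.vecMul_one, Matrix.dotProduct_mulVec]

lemma inner_nullityEndomorphism_comm (w z : TangentSpace (𝓡 n) p) :
    g.inner p (nullityEndomorphism g p w) z = g.inner p w (nullityEndomorphism g p z) := by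
  have hsymm := (isMetricOn_metricInChart g p).nullityForm_isSymm (mem_extChartAt_target p)
  rw [g.symm p w, inner_nullityEndomorphism, inner_nullityEndomorphism, dotProduct_comm,
    ← Matrix.vecMul_transpose, hsymm, Matrix.dotProduct_mulVec]

namespace IsCurvatureNull

lemma inner_nullityEndomorphism_eq_zero
    (hv : IsCurvatureNull (metricInChart g p) (extChartAt (𝓡 n) p p) (tangentCoords p v))
    {w : TangentSpace (𝓡 n) p} (hw : g.inner p v w = 0) :
    g.inner p v (nullityEndomorphism g p w) = 0 := by
  rw [← inner_nullityEndomorphism_comm, inner_nullityEndomorphism, Matrix.dotProduct_mulVec,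
    hv.vecMul_nullityForm (isMetricOn_metricInChart g p) (mem_extChartAt_target p),
    smul_dotProduct, ← Matrix.dotProduct_mulVec, ← inner_eq_dotProduct, hw, smul_zero]

lemma weylOperator_wedge
    (hv : IsCurvatureNull (metricInChart g p) (extChartAt (𝓡 n) p p) (tangentCoords p v))
    (w : TangentSpace (𝓡 n) p) :
    weylOperator g p (wedge v w) = wedge v (nullityEndomorphism g p w) := by
  have hraise (u : Fin n → ℝ) : (inverseMetricAt g p)ᵀ *ᵥ u = u ᵥ* inverseMetricAt g p :=
    Matrix.mulVec_transpose _ _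
  have hraise_lower (u : Fin n → ℝ) :
      u ᵥ* metricInChart g p (extChartAt (𝓡 n) p p) ᵥ* inverseMetricAt g p = u := by
    rw [inverseMetricAt, Matrix.vecMul_vecMul, Matrix.mul_nonsing_inv _
      (isUnit_det_metricInChart g p (mem_extChartAt_target p)), Matrix.vecMul_one]
  rw [weylOperator_wedge_eq_sum,
    hv.sum_smul_weylMatrix (isMetricOn_metricInChart g p) (mem_extChartAt_target p),
    Matrix.mul_sub, Matrix.sub_mul, Matrix.mul_vecMulVec, Matrix.mul_vecMulVec,
    Matrix.vecMulVec_mul, Matrix.vecMulVec_mul, hraise, hraise, hraise_lower,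
    ← tangentCoords_nullityEndomorphism, map_sub, bivectorOfMatrix_vecMulVec,
    bivectorOfMatrix_vecMulVec, wedge_swap]
  module

lemma mapsTo_flag
    (hv : IsCurvatureNull (metricInChart g p) (extChartAt (𝓡 n) p p) (tangentCoords p v)) :
    Set.MapsTo (weylOperator g p) (flag g p v) (flag g p v) := by
  rintro _ ⟨w, hw, rfl⟩
  exact ⟨nullityEndomorphism g p w, hv.inner_nullityEndomorphism_eq_zero hw,
    hv.weylOperator_wedge w⟩

end IsCurvatureNull

end WeylOperator

section Eigenvectors

lemma exists_linearIndependent_eigenvectors {V : Type*} [AddCommGroup V] [Module ℝ V]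
    [FiniteDimensional ℝ V] (B : V →ₗ[ℝ] V →ₗ[ℝ] ℝ) (hsymm : ∀ x y, B x y = B y x)
    (hpos : ∀ x, x ≠ 0 → 0 < B x x) (A : Module.End ℝ V) (hA : ∀ x y, B (A x) y = B x (A y))
    {m : ℕ} (hm : Module.finrank ℝ V = m) :
    ∃ b : Fin m → V, LinearIndependent ℝ b ∧ ∀ i, ∃ μ : ℝ, A (b i) = μ • b i := by
  let core : InnerProductSpace.Core ℝ V :=
    { inner x y := B x y
      conj_inner_symm x y := hsymm y x
      re_inner_nonneg x := by
        rcases eq_or_ne x 0 with rfl | hx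
        · rw [map_zero, map_zero]
        · exact (hpos x hx).le
      add_left x y z := by rw [map_add, LinearMap.add_apply]
      smul_left x y c := by rw [map_smul, LinearMap.smul_apply]; rfl
      definite x hx := not_imp_comm.mp (hpos x) hx.not_gt }
  let _ : NormedAddCommGroup V := core.toNormedAddCommGroup
  let _ : InnerProductSpace ℝ V := InnerProductSpace.ofCore core.toCore
  have hsymmetric : A.IsSymmetric := hA
  exact ⟨hsymmetric.eigenvectorBasis hm,
    (hsymmetric.eigenvectorBasis hm).orthonormal.linearIndependent,
    fun i => ⟨hsymmetric.eigenvalues hm i, hsymmetric.apply_eigenvectorBasis hm i⟩⟩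

variable {n : ℕ} {M : Type*} [TopologicalSpace M] [ChartedSpace (EuclideanSpace ℝ (Fin n)) M]
  [IsManifold (𝓡 n) ∞ M] {g : SmoothMetric n M} {p : M} {v : TangentSpace (𝓡 n) p}

variable (g v) in
/-- The orthogonal complement of `v` in the tangent space at `p`. -/
def perp : Submodule ℝ (TangentSpace (𝓡 n) p) :=
  LinearMap.ker (g.inner p v).toLinearMap

lemma mem_perp {w : TangentSpace (𝓡 n) p} : w ∈ perp g v ↔ g.inner p v w = 0 :=
  Iff.rfl

instance : FiniteDimensional ℝ (TangentSpace (𝓡 n) p) :=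
  inferInstanceAs (FiniteDimensional ℝ (EuclideanSpace ℝ (Fin n)))

lemma finrank_perp (hv : v ≠ 0) : Module.finrank ℝ (perp g v) = n - 1 := by
  have hne : (g.inner p v).toLinearMap ≠ 0 := fun h =>
    (g.pos p v hv).ne' (congrArg (fun L => L v) h)
  have hrank := Module.Dual.finrank_ker_add_one_of_ne_zero hne
  rw [(tangentCoords p).finrank_eq, Module.finrank_fin_fun] at hrank
  exact Nat.eq_sub_of_add_eq hrank

lemma ker_wedgeBilin_comp_subtype_perp (hv : v ≠ 0) :
    LinearMap.ker (wedgeBilin p v ∘ₗ (perp g v).subtype) = ⊥ := by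
  rw [LinearMap.ker_eq_bot']
  rintro ⟨w, hw⟩ hvw
  obtain ⟨c, rfl⟩ := exists_eq_smul_of_wedge_eq_zero hv hvw
  rw [mem_perp, map_smul, smul_eq_zero, or_iff_left (g.pos p v hv).ne'] at hw
  exact Subtype.ext ((congrArg (· • v) hw).trans (zero_smul ℝ v))

lemma IsCurvatureNull.exists_eigenvectors
    (hv : IsCurvatureNull (metricInChart g p) (extChartAt (𝓡 n) p p) (tangentCoords p v))
    (hv0 : v ≠ 0) :
    ∃ b : Fin (n - 1) → Bivector n p, LinearIndependent ℝ b ∧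
      ∀ i, IsSimpleBivector (b i) ∧ ∃ μ : ℝ, weylOperator g p (b i) = μ • b i := by
  let B : perp g v →ₗ[ℝ] perp g v →ₗ[ℝ] ℝ :=
    LinearMap.mk₂ ℝ (fun x y => g.inner p x y) (by simp) (by simp) (by simp) (by simp)
  let A : Module.End ℝ (perp g v) := (nullityEndomorphism g p).restrict fun w hw =>
    hv.inner_nullityEndomorphism_eq_zero hw
  obtain ⟨w, hw, heigen⟩ := exists_linearIndependent_eigenvectors B (fun x y => g.symm p x y)
    (fun x hx => g.pos p x (by simpa using hx)) A
    (fun x y => inner_nullityEndomorphism_comm (x : TangentSpace (𝓡 n) p) y) (finrank_perp hv0)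
  refine ⟨_, hw.map' _ (ker_wedgeBilin_comp_subtype_perp hv0), fun i => ⟨⟨v, w i, rfl⟩, ?_⟩⟩
  obtain ⟨μ, hμ⟩ := heigen i
  refine ⟨μ, ?_⟩
  calc weylOperator g p (wedge v (w i))
      = wedge v (nullityEndomorphism g p (w i)) := hv.weylOperator_wedge _
    _ = wedgeBilin p v (μ • (w i : TangentSpace (𝓡 n) p)) :=
        congrArg (wedge v) (congrArg Subtype.val hμ)
    _ = μ • wedge v (w i) := map_smul _ _ _

end Eigenvectors

section ConformalClass

variable {n : ℕ} {M : Type*} [TopologicalSpace M] [ChartedSpace (EuclideanSpace ℝ (Fin n)) M]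
  [IsManifold (𝓡 n) ∞ M] {g g' g'' : SmoothMetric n M}

namespace IsConformalTo

lemma symm (h : IsConformalTo g g') : IsConformalTo g' g := by
  obtain ⟨f, hf, hg⟩ := h
  refine ⟨fun p => -f p, hf.neg, fun p v w => ?_⟩
  rw [hg, ← mul_assoc, ← Real.exp_add, ← mul_add, neg_add_cancel, mul_zero, Real.exp_zero, one_mul]

lemma trans (h : IsConformalTo g g') (h' : IsConformalTo g' g'') : IsConformalTo g g'' := by
  obtain ⟨f, hf, hg⟩ := h
  obtain ⟨f', hf', hg'⟩ := h'
  refine ⟨fun p => f' p + f p, hf'.add hf, fun p v w => ?_⟩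
  rw [hg', hg, ← mul_assoc, ← Real.exp_add, mul_add]

lemma flag_eq (h : IsConformalTo g g') (p : M) (v : TangentSpace (𝓡 n) p) :
    flag g' p v = flag g p v := by
  obtain ⟨f, -, hg⟩ := h
  ext b
  refine exists_congr fun w => and_congr_left fun _ => ?_
  rw [hg, mul_eq_zero, or_iff_right (Real.exp_pos _).ne']

lemma exists_weylOperator_eq_smul (h : IsConformalTo g g') (hn : 3 ≤ n) (p : M) :
    ∃ c : ℝ, weylOperator g' p = c • weylOperator g p := by
  obtain ⟨f, hf, hg⟩ := h
  have hy := mem_extChartAt_target (I := 𝓡 n) p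
  have hφ : ContDiffOn ℝ ∞ (f ∘ (extChartAt (𝓡 n) p).symm) (extChartAt (𝓡 n) p).target :=
    contMDiffOn_iff_contDiffOn.mp (hf.comp_contMDiffOn (contMDiffOn_extChartAt_symm p))
  have hGG' : ∀ z ∈ (extChartAt (𝓡 n) p).target, metricInChart g' p z
      = Real.exp (2 * (f ∘ (extChartAt (𝓡 n) p).symm) z) • metricInChart g p z :=
    fun z _ => Matrix.ext fun i j => hg _ _ _
  have hG := isMetricOn_metricInChart g p
  have hinv := hG.inv_conformal hGG' hy
  have hweyl := hG.weylMatrix_conformal hn (isMetricOn_metricInChart g' p) hφ hGG' hy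
  have hne : Real.exp (2 * (f ∘ (extChartAt (𝓡 n) p).symm) (extChartAt (𝓡 n) p p)) ≠ 0 :=
    Real.exp_ne_zero _
  generalize Real.exp (2 * (f ∘ (extChartAt (𝓡 n) p).symm) (extChartAt (𝓡 n) p p)) = e
    at hinv hweyl hne
  refine ⟨e⁻¹, LinearMap.ext fun b => ?_⟩
  rw [LinearMap.smul_apply, weylOperator_apply, weylOperator_apply, inverseMetricAt, hinv,
    ← inverseMetricAt]
  simp only [hweyl, smul_comm _ e, ← Finset.smul_sum, Matrix.transpose_smul, Matrix.smul_mul,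
    Matrix.mul_smul, map_smul]
  simp only [smul_smul]
  congr 1
  field_simp

end IsConformalTo

lemma smul_mem_flag {p : M} {v : TangentSpace (𝓡 n) p} {b : Bivector n p} (c : ℝ)
    (hb : b ∈ flag g p v) : c • b ∈ flag g p v := by
  obtain ⟨w, hw, rfl⟩ := hb
  exact ⟨c • w, by rw [map_smul, hw, smul_zero], (map_smul (wedgeBilin p v) c w).symm⟩

end ConformalClass

end ConformalWeyl

end

theorem theorem1p3_general {n : ℕ} (hn : 3 ≤ n) {M : Type*} [TopologicalSpace M]
    [ChartedSpace (EuclideanSpace ℝ (Fin n)) M] [IsManifold (𝓡 n) ∞ M]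
    (g : ConformalWeyl.SmoothMetric n M) (p : M)
    (h : ∃ g' : ConformalWeyl.SmoothMetric n M, ConformalWeyl.IsConformalTo g g' ∧
      ∃ v : TangentSpace (𝓡 n) p, v ≠ 0 ∧
        ConformalWeyl.IsCurvatureNull (ConformalWeyl.metricInChart g' p) (extChartAt (𝓡 n) p p)
          (ConformalWeyl.tangentCoords p v)) :
    (∃ v : TangentSpace (𝓡 n) p, v ≠ 0 ∧
      ∀ g' : ConformalWeyl.SmoothMetric n M, ConformalWeyl.IsConformalTo g g' →
        Set.MapsTo (ConformalWeyl.weylOperator g' p)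
          (ConformalWeyl.flag g' p v) (ConformalWeyl.flag g' p v)) ∧
    ∀ g' : ConformalWeyl.SmoothMetric n M, ConformalWeyl.IsConformalTo g g' →
      ∃ b : Fin (n - 1) → ConformalWeyl.Bivector n p, LinearIndependent ℝ b ∧
        ∀ i, ConformalWeyl.IsSimpleBivector (b i) ∧
          ∃ μ : ℝ, (ConformalWeyl.weylOperator g' p).HasEigenvector μ (b i) := by
  obtain ⟨g₀, hg₀, v, hv, hnull⟩ := h
  refine ⟨⟨v, hv, fun g' hg' => ?_⟩, fun g' hg' => ?_⟩
  all_goals obtain ⟨c, hc⟩ := (hg₀.symm.trans hg').exists_weylOperator_eq_smul hn p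
  · rw [(hg₀.symm.trans hg').flag_eq, hc]
    exact fun b hb => ConformalWeyl.smul_mem_flag c (hnull.mapsTo_flag hb)
  · obtain ⟨b, hb, heigen⟩ := hnull.exists_eigenvectors hv
    refine ⟨b, hb, fun i => ?_⟩
    obtain ⟨hsimple, μ, hμ⟩ := heigen i
    refine ⟨hsimple, c * μ, Module.End.mem_eigenspace_iff.mpr ?_, hb.ne_zero i⟩
    rw [hc, LinearMap.smul_apply, hμ, smul_smul]

theorem theorem1p3 {n : ℕ} (hn : 4 ≤ n) {M : Type*} [TopologicalSpace M]
    [ChartedSpace (EuclideanSpace ℝ (Fin n)) M] [IsManifold (𝓡 n) ∞ M]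
    (g : ConformalWeyl.SmoothMetric n M)
    (h : ∃ g' : ConformalWeyl.SmoothMetric n M,
      ConformalWeyl.IsConformalTo g g' ∧ ConformalWeyl.AdmitsParallelField g') (p : M) :
    (∃ v : TangentSpace (𝓡 n) p, v ≠ 0 ∧
      ∀ g' : ConformalWeyl.SmoothMetric n M, ConformalWeyl.IsConformalTo g g' →
        Set.MapsTo (ConformalWeyl.weylOperator g' p)
          (ConformalWeyl.flag g' p v) (ConformalWeyl.flag g' p v)) ∧
    ∀ g' : ConformalWeyl.SmoothMetric n M, ConformalWeyl.IsConformalTo g g' →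
      ∃ b : Fin (n - 1) → ConformalWeyl.Bivector n p, LinearIndependent ℝ b ∧
        ∀ i, ConformalWeyl.IsSimpleBivector (b i) ∧
          ∃ μ : ℝ, (ConformalWeyl.weylOperator g' p).HasEigenvector μ (b i) := by
  obtain ⟨g₀, hg₀, hpar⟩ := h
  exact theorem1p3_general (by omega) g p ⟨g₀, hg₀, hpar.exists_isCurvatureNull p⟩
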